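/- **Setting.** Let $\Theta\subseteq\mathbb R^p$ be closed and convex and let $f:\mathbb R^p\to\mathbb R$ be bounded below on $\Theta$ and $\rho$-weakly convex on $\Theta$ ($\rho>0$), i.e. $f+\frac\rho2\|\cdot\|^2$ is convex on $\Theta$. Put $\varphi=f+\iota_\Theta$ ($\iota_\Theta=0$ on $\Theta$, $+\infty$ elsewhere). For $\hat\rho\ge 2\rho$ let $\varphi_{1/\hat\rho}(\theta)=\min_{\theta'}\{\varphi(\theta')+\frac{\hat\rho}2\|\theta'-\theta\|^2\}$ be the Moreau envelope and $\mathrm{prox}_{\varphi/\hat\rho}(\theta)$ the (unique) minimizer; $\varphi_{1/\hat\rho}$ is differentiable. Let $\partial f(\theta^*)$ be the set of $v$ with $f(\theta)-f(\theta^*)\ge\langle v,\theta-\theta^*\rangle+o(\|\theta-\theta^*\|)$ as $\theta\to\theta^*$. A point $\theta^*\in\Theta$ is *stationary* for $f$ over $\Theta$ if some $v\in\partial f(\theta^*)$ satisfies $\langle v,\theta-\theta^*\rangle\ge0$ for all $\theta\in\Theta$. Let $(\mathbf x_n)_{n\ge1}$ be random variables with values in a (standard Borel) space $\mathcal X$,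 let $\pi$ be a probability measure on $\mathcal X$, and let $$\Delta_{[m,n]}=\operatorname*{ess\,sup}_{\mathbf x_1,\dots,\mathbf x_m}\big\|\mathrm{Law}(\mathbf x_n\mid \mathbf x_1,\dots,\mathbf x_m)-\pi\big\|_{TV},\qquad \|\mu-\nu\|_{TV}=\sup_A|\mu(A)-\nu(A)|$$ (for $m=0$ nothing is conditioned on). Let $(\alpha_t)_{t\ge1}$ be positive and nonincreasing, with the convention $\alpha_0:=\alpha_1$. Assume: * **(A1)** there are integers $k_t\in[1,t]$ with $k_t\to\infty$, $\Delta_{[t-k_t,t+1]}\to0$ and $\sum_t\alpha_t\Delta_{[t-k_t,t+1]}<\infty$; * **(A2)** $G:\Theta\times\mathcal X\to\mathbb R^p$ satisfies $\mathbb E_{\mathbf x\sim\pi}[G(\theta,\mathbf x)]\in\partial f(\theta)$ for all $\theta\in\Theta$, and $\theta\mapsto G(\theta,\mathbf x)$ is $L_1$-Lipschitz on $\Theta$ for every $\mathbf x$ ($L_1>0$); * **(A3)** $\|G(\theta,\mathbf x)\|\le L$ for all $\theta\in\Theta$, $\mathbf x\in\mathcal X$ ($0<L<\infty$). **Algorithm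 (projected stochastic heavy ball).** Let $\beta\in(0,1]$, $\theta_0=\theta_1\in\Theta$, $z_1\in\mathbb R^p$ be deterministic, and for $t\ge1$ $$\theta_{t+1}=\mathrm{proj}_\Theta(\theta_t-\alpha_tz_t),\qquad z_{t+1}=\beta\,G(\theta_{t+1},\mathbf x_{t+1})+\tfrac{1-\beta}{\alpha_{t+1}}(\theta_t-\theta_{t+1}).$$ For $t\ge1$ put $\bar\theta_t=\theta_t+\frac{1-\beta}\beta(\theta_t-\theta_{t-1})$ and $\hat\theta_t=\mathrm{prox}_{\varphi/\hat\rho}(\bar\theta_t)$. For $T\ge1$ let $\bar\theta_T^{\rm out}$ be either $\bar\theta_\tau$, where $\tau$ is independent of the data with $\mathbb P(\tau=j)=\alpha_j/\sum_{t=1}^T\alpha_t$ for $1\le j\le T$, or an element of $\{\bar\theta_1,\dots,\bar\theta_T\}$ that minimizes $\|\nabla\varphi_{1/\hat\rho}(\cdot)\|$. **Theorem (stochastic heavy ball).** Let $C=5+\hat\rho\alpha_1+\frac{4(L_1+\hat\rho)}{\hat\rho-\rho}$. (i) For each $T\ge1$, $\|\nabla\varphi_{1/\hat\rho}(\bar\theta_T^{\rm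 out})\|^2$ is integrable and $$\mathbb E\|\nabla\varphi_{1/\hat\rho}(\bar\theta^{\rm out}_T)\|^2\le\frac1{\sum_{t=1}^T\alpha_t}\Bigg(6\big(\varphi_{1/\hat\rho}(\theta_1)-\inf\varphi_{1/\hat\rho}\big)+\hat\rho\Big[\Big(6+\tfrac{C(1-\beta)^2}{\beta^2}\Big)L^2\sum_{t=1}^T\alpha_t^2+\tfrac{C}{\beta^3}\alpha_1^2\|z_1\|^2+\tfrac{4L^2}{\hat\rho-\rho}\sum_{t=1}^T\alpha_t\Delta_{[t-k_t,t+1]}+\tfrac{16L^2(L_1+\hat\rho)}{\hat\rho-\rho}\sum_{t=1}^Tk_t\alpha_t\alpha_{t-k_t}\Big]\Bigg).$$ (ii) Assume in addition that $\sum_t\alpha_t=\infty$, $\alpha_t/\alpha_{t+1}\to1$ and $\sum_tk_t\alpha_t\alpha_{t-k_t}<\infty$. Then, almost surely, $\|\nabla\varphi_{1/\hat\rho}(\cdot)\|\to0$ along each of the sequences $\theta_t$, $\bar\theta_t$ and $\hat\theta_t$. If moreover $f$ is continuously differentiable (on a neighbourhood of $\Theta$), then, almost surely, every limit point of $(\theta_t)$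 is a stationary point of $f$ over $\Theta$, and if $(\theta_t)$ is bounded (e.g. if $\Theta$ is bounded), the set of stationary points is nonempty and the distance of $\theta_t$ to it tends to $0$. -/

import Mathlib

open MeasureTheory ProbabilityTheory Filter Topology

noncomputable section

/-- Total variation distance `sup_A |μ(A) - ν(A)|` of two (probability) measures. -/
def tvDist {X : Type*} [MeasurableSpace X] (μ ν : Measure X) : ℝ :=
  ⨆ A : {A : Set X // MeasurableSet A}, |μ.real A.1 - ν.real A.1|

/-- The first `m` samples `(x₁, …, x_m)`. -/
def history {Ω X : Type*} (x : ℕ → Ω → X) (m : ℕ) (ω : Ω) : Fin m → X :=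
  fun i => x (i.1 + 1) ω

/-- The mixing coefficient `Δ_{[m,n]}`: the worst case over `(x₁, …, x_m)` of the total variation
distance between the conditional law of `x_n` given `x₁, …, x_m` and `π`.  A conditional law is only
determined almost everywhere, so the worst case is an essential supremum over the histories. -/
def mixingCoeff {Ω X : Type*} [MeasurableSpace Ω] [MeasurableSpace X] [StandardBorelSpace X]
    [Nonempty X] (P : Measure Ω) [IsFiniteMeasure P] (π : Measure X) (x : ℕ → Ω → X)
    (m n : ℕ) : ℝ :=
  essSup (fun h : Fin m → X => tvDist (condDistrib (x n) (history x m) P h) π)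
    (P.map (history x m))

section Variational

variable {E : Type*} [NormedAddCommGroup E] [InnerProductSpace ℝ E]

/-- `f` is `ρ`-weakly convex on `Θ`: `f + (ρ/2) ‖·‖²` is convex on `Θ`. -/
def WeaklyConvexOn (ρ : ℝ) (Θ : Set E) (f : E → ℝ) : Prop :=
  ConvexOn ℝ Θ (fun θ => f θ + ρ / 2 * ‖θ‖ ^ 2)

/-- The (Fréchet) subdifferential: all `v` with
`f θ - f θ₀ ≥ ⟪v, θ - θ₀⟫ + o(‖θ - θ₀‖)` as `θ → θ₀`. -/
def subdifferential (f : E → ℝ) (θ₀ : E) : Set E :=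
  {v | ∀ ε : ℝ, 0 < ε → ∀ᶠ θ in 𝓝 θ₀,
    inner ℝ v (θ - θ₀) - ε * ‖θ - θ₀‖ ≤ f θ - f θ₀}

/-- The normal cone of `Θ` at `θ₀`. -/
def normalCone (Θ : Set E) (θ₀ : E) : Set E :=
  {u | ∀ θ ∈ Θ, inner ℝ u (θ - θ₀) ≤ 0}

/-- The stationary points of `f` over `Θ`: points `θ₀ ∈ Θ` with `0 ∈ v + N_Θ(θ₀)` for some
subgradient `v` of `f` at `θ₀`. -/
def stationarySet (f : E → ℝ) (Θ : Set E) : Set E :=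
  {θ₀ | θ₀ ∈ Θ ∧ ∃ v ∈ subdifferential f θ₀, -v ∈ normalCone Θ θ₀}

/-- The Moreau envelope `φ_lam(θ) = inf_{θ'} (φ(θ') + ‖θ' - θ‖² / (2 lam))` of `φ = f + ι_Θ`.
As `φ = f` on `Θ` and `φ = +∞` off `Θ`, the infimum runs over `Θ`. -/
def moreauEnvelope (f : E → ℝ) (Θ : Set E) (lam : ℝ) (θ : E) : ℝ :=
  ⨅ θ' : Θ, (f θ' + 1 / (2 * lam) * ‖(θ' : E) - θ‖ ^ 2)

/-- `q` minimizes `φ(θ') + ‖θ' - θ‖² / (2 lam)` over all `θ'`, where `φ = f + ι_Θ`. -/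
def IsProxPoint (f : E → ℝ) (Θ : Set E) (lam : ℝ) (θ q : E) : Prop :=
  q ∈ Θ ∧ ∀ θ' ∈ Θ,
    f q + 1 / (2 * lam) * ‖q - θ‖ ^ 2 ≤ f θ' + 1 / (2 * lam) * ‖θ' - θ‖ ^ 2

/-- The proximal point of `θ`: the minimizer in `IsProxPoint`. -/
def proxPoint (f : E → ℝ) (Θ : Set E) (lam : ℝ) (θ : E) : E :=
  Classical.epsilon (IsProxPoint f Θ lam θ)

/-- `q` is the projection of `y` onto `Θ`, i.e. a nearest point of `Θ` to `y`. -/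
def IsProjOnto (Θ : Set E) (y q : E) : Prop :=
  q ∈ Θ ∧ ∀ θ ∈ Θ, ‖y - q‖ ≤ ‖y - θ‖

/-- The projected stochastic heavy ball iteration with initial point `θ₀ = θ₁ = θinit`, initial
momentum vector `z₁ = zinit`, step sizes `α`, momentum parameter `β`, data `x` and stochastic
subgradients `G θ (x t)`:  for `t ≥ 1`,
`θ_{t+1} = proj_Θ (θ_t - α_t z_t)` and
`z_{t+1} = β G(θ_{t+1}, x_{t+1}) + ((1 - β) / α_{t+1}) (θ_t - θ_{t+1})`. -/
structure IsStochasticHeavyBall {Ω X : Type*} (Θ : Set E) (G : E → X → E) (α : ℕ → ℝ) (β : ℝ)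
    (θinit zinit : E) (x : ℕ → Ω → X) (θ z : ℕ → Ω → E) : Prop where
  theta_zero : ∀ ω, θ 0 ω = θinit
  theta_one : ∀ ω, θ 1 ω = θinit
  z_one : ∀ ω, z 1 ω = zinit
  theta_step : ∀ t, 1 ≤ t → ∀ ω, IsProjOnto Θ (θ t ω - α t • z t ω) (θ (t + 1) ω)
  z_step : ∀ t, 1 ≤ t → ∀ ω, z (t + 1) ω =
    β • G (θ (t + 1) ω) (x (t + 1) ω) + ((1 - β) / α (t + 1)) • (θ t ω - θ (t + 1) ω)

/-- The extrapolated iterate `θ̄_t = θ_t + ((1 - β) / β) (θ_t - θ_{t-1})`, for `t ≥ 1`. -/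
def extrapolate {Ω : Type*} (β : ℝ) (θ : ℕ → Ω → E) (t : ℕ) (ω : Ω) : E :=
  θ t ω + ((1 - β) / β) • (θ t ω - θ (t - 1) ω)

end Variational

/-- `τ` is drawn from `{1, …, T}` with `P(τ = j) = α_j / ∑_{t ≤ T} α_t`, independently of the
data `x₁, x₂, …`. -/
structure IsRandomIndex {Ω X : Type*} [MeasurableSpace Ω] [MeasurableSpace X] (P : Measure Ω)
    (α : ℕ → ℝ) (x : ℕ → Ω → X) (T : ℕ) (τ : Ω → ℕ) : Prop where
  measurable : Measurable τ
  law : ∀ j ∈ Finset.Icc 1 T, P.real {ω | τ ω = j} = α j / ∑ t ∈ Finset.Icc 1 T, α t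
  indep : IndepFun τ (fun ω (n : ℕ) => x (n + 1) ω) P

/-- `τ ω` minimizes `g t ω` over `t ∈ {1, …, T}`, for every `ω`. -/
def IsBestIndex {Ω : Type*} (g : ℕ → Ω → ℝ) (T : ℕ) (τ : Ω → ℕ) : Prop :=
  ∀ ω, τ ω ∈ Finset.Icc 1 T ∧ ∀ t ∈ Finset.Icc 1 T, g (τ ω) ω ≤ g t ω

/-- The constant `5 + ρ̂ α₁ + 4 (L₁ + ρ̂) / (ρ̂ - ρ)` of the rate. -/
def shbConst (ρ ρhat L₁ α₁ : ℝ) : ℝ :=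
  5 + ρhat * α₁ + 4 * (L₁ + ρhat) / (ρhat - ρ)

end

/-! The extrapolated iterates remove the momentum. With respect to any point of `Θ`, the step from
`θ̄_t` to `θ̄_{t+1}` contracts at least as well as the plain stochastic subgradient step `θ̄_t - α_t
G(θ_t, x_t)` (`IsProjOnto.extrapolate_norm_le`, `extrapolate_step`). Testing the Moreau envelope at
`θ̄_{t+1}` with the proximal point of `θ̄_t` then gives a descent inequality
(`HeavyBallModel.descent`): `α_t` times the squared envelope gradient is at most the decrease of the
envelope plus `α_t ^ 2` terms, the gap `‖θ̄_t - θ_t‖ ^ 2`, and a noise term, the inner product of `G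
- g` with the proximal residual at `θ_t`.

The data are dependent, so the noise at `θ_t` is not centred. It is replaced by the noise at an
iterate `θ_s` about `k` steps earlier. The noise is Lipschitz in the iterate, so the cost is the
path length from `s` to `t`, and the recursion for the increments bounds the weighted sum of these
lengths (`sum_mul_window_le`). The iterate `θ_s` is a function of old samples only, so the expected
noise there is controlled by the mixing coefficient (`abs_integral_noiseTerm_le`). Summation gives
`pathwise_rate` and `expected_rate`, and averaging over the random or best index gives (i).

For (ii) the bound stays finite as `T` grows, so the weighted squared residuals are almost surely
summable. Increments of order `α_t` and divergence of the sum of the `α_t` upgrade this to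
convergence of the residuals (`tendsto_zero_of_summable_mul_sq`). The residual is nonexpansive,
which transfers the limit to `θ_t` and `θ̂_t`. Limit points of `θ_t` are fixed points of the
proximal map, hence stationary. -/

/-! ### Weak convexity, proximal points and the Moreau envelope. -/

section Variational

variable {E : Type*} [NormedAddCommGroup E] [InnerProductSpace ℝ E]
  {f : E → ℝ} {Θ : Set E} {ρ r L : ℝ}

/-- The squared norm of a point on a segment. -/
theorem norm_sq_segment (u v : E) (s : ℝ) :
    ‖(1 - s) • u + s • v‖ ^ 2 = (1 - s) * ‖u‖ ^ 2 + s * ‖v‖ ^ 2 - s * (1 - s) * ‖v - u‖ ^ 2 := by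
  rw [norm_add_sq_real, norm_sub_sq_real, norm_smul, norm_smul, mul_pow, mul_pow,
    real_inner_smul_left, real_inner_smul_right, Real.norm_eq_abs, Real.norm_eq_abs, sq_abs,
    sq_abs, real_inner_comm]
  ring

theorem WeaklyConvexOn.segment_le (hf : WeaklyConvexOn ρ Θ f) {u v : E} (hu : u ∈ Θ) (hv : v ∈ Θ)
    {s : ℝ} (hs0 : 0 ≤ s) (hs1 : s ≤ 1) :
    f ((1 - s) • u + s • v) ≤
      (1 - s) * f u + s * f v + ρ / 2 * (s * (1 - s) * ‖v - u‖ ^ 2) := by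
  have h := hf.2 hu hv (sub_nonneg.2 hs1) hs0 (by ring)
  simp only [smul_eq_mul] at h
  rw [norm_sq_segment] at h
  linarith

/-- Subgradients of a weakly convex function satisfy a global quadratic lower bound. -/
theorem WeaklyConvexOn.le_of_mem_subdifferential (hρ : 0 ≤ ρ) (hf : WeaklyConvexOn ρ Θ f)
    {u v w : E} (hu : u ∈ Θ) (hv : v ∈ Θ) (hw : w ∈ subdifferential f u) :
    f u + inner ℝ w (v - u) - ρ / 2 * ‖v - u‖ ^ 2 ≤ f v := by
  refine le_of_forall_pos_le_add fun ε hε => ?_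
  have hδ : 0 < ε / (‖v - u‖ + 1) := by positivity
  have hlim : Tendsto (fun s : ℝ => (1 - s) • u + s • v) (𝓝[>] 0) (𝓝 u) := by
    have : Continuous fun s : ℝ => (1 - s) • u + s • v := by fun_prop
    have h := (this.tendsto 0).mono_left (nhdsWithin_le_nhds (s := Set.Ioi (0 : ℝ)))
    simpa using h
  -- A single small `s` suffices: the local subgradient inequality at the segment point, combined
  -- with the weak convexity bound on the chord, is divided by `s`.
  obtain ⟨s, hs, hs0, hs1⟩ := ((hlim.eventually (hw _ hδ)).and
    (Ioo_mem_nhdsGT (zero_lt_one' ℝ))).exists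
  have hseg := hf.segment_le hu hv hs0.le hs1.le
  have hd : (1 - s) • u + s • v - u = s • (v - u) := by module
  rw [hd, real_inner_smul_right, norm_smul, Real.norm_of_nonneg hs0.le] at hs
  have h1 : ε / (‖v - u‖ + 1) * ‖v - u‖ ≤ ε := by
    rw [div_mul_eq_mul_div, div_le_iff₀ (by positivity)]
    nlinarith [norm_nonneg (v - u)]
  have h2 : s * (inner ℝ w (v - u) - ε - ρ / 2 * ‖v - u‖ ^ 2) ≤ s * (f v - f u) := by
    have h3 : 0 ≤ ρ / 2 * (s * s * ‖v - u‖ ^ 2) := by positivity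
    have h4 := mul_le_mul_of_nonneg_left h1 hs0.le
    linarith
  linarith [le_of_mul_le_mul_left h2 hs0]

omit [InnerProductSpace ℝ E] in
theorem isProxPoint_iff {x q : E} : IsProxPoint f Θ (1 / r) x q ↔
    q ∈ Θ ∧ ∀ u ∈ Θ, f q + r / 2 * ‖q - x‖ ^ 2 ≤ f u + r / 2 * ‖u - x‖ ^ 2 := by
  have : 1 / (2 * (1 / r)) = r / 2 := by
    rw [mul_one_div, one_div_div]
  rw [IsProxPoint, this]

/-- Quadratic growth of the proximal objective away from its minimizer. -/
theorem IsProxPoint.quadratic_growth (hf : WeaklyConvexOn ρ Θ f) {x q u : E}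
    (hq : IsProxPoint f Θ (1 / r) x q) (hu : u ∈ Θ) :
    f q + r / 2 * ‖q - x‖ ^ 2 + (r - ρ) / 2 * ‖u - q‖ ^ 2 ≤ f u + r / 2 * ‖u - x‖ ^ 2 := by
  obtain ⟨hqΘ, hmin⟩ := isProxPoint_iff.1 hq
  have key : ∀ s ∈ Set.Ioo (0 : ℝ) 1,
      f q + r / 2 * ‖q - x‖ ^ 2 + (1 - s) * ((r - ρ) / 2 * ‖u - q‖ ^ 2) ≤
        f u + r / 2 * ‖u - x‖ ^ 2 := by
    intro s hs
    have h1 := hmin _ (hf.1 hqΘ hu (sub_nonneg.2 hs.2.le) hs.1.le (by ring))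
    have h2 := hf.segment_le hqΘ hu hs.1.le hs.2.le
    have h3 := norm_sq_segment (q - x) (u - x) s
    have h4 : (1 - s) • (q - x) + s • (u - x) = (1 - s) • q + s • u - x := by module
    rw [h4, sub_sub_sub_cancel_right] at h3
    rw [h3] at h1
    refine le_of_mul_le_mul_left ?_ hs.1
    linarith
  have hlim : Tendsto (fun s : ℝ =>
      f q + r / 2 * ‖q - x‖ ^ 2 + (1 - s) * ((r - ρ) / 2 * ‖u - q‖ ^ 2)) (𝓝[>] 0)
      (𝓝 (f q + r / 2 * ‖q - x‖ ^ 2 + (r - ρ) / 2 * ‖u - q‖ ^ 2)) := by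
    have : Continuous fun s : ℝ =>
      f q + r / 2 * ‖q - x‖ ^ 2 + (1 - s) * ((r - ρ) / 2 * ‖u - q‖ ^ 2) := by fun_prop
    simpa using (this.tendsto 0).mono_left (nhdsWithin_le_nhds (s := Set.Ioi (0 : ℝ)))
  exact le_of_tendsto hlim (Filter.mem_of_superset (Ioo_mem_nhdsGT (zero_lt_one' ℝ)) key)

/-- Each proximal point is tested against the other in the quadratic growth inequality, and the two
are added. This strong monotonicity yields uniqueness, Lipschitz continuity and nonexpansiveness of
the residual. -/
theorem IsProxPoint.inner_ge (hf : WeaklyConvexOn ρ Θ f) {x q x' q' : E}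
    (hq : IsProxPoint f Θ (1 / r) x q) (hq' : IsProxPoint f Θ (1 / r) x' q') :
    (r - ρ) * ‖q - q'‖ ^ 2 ≤ r * inner ℝ (x - x') (q - q') := by
  have h1 := hq.quadratic_growth hf hq'.1
  have h2 := hq'.quadratic_growth hf hq.1
  rw [norm_sub_rev q' q] at h1
  have h3 : ‖q' - x‖ ^ 2 - ‖q - x‖ ^ 2 + (‖q - x'‖ ^ 2 - ‖q' - x'‖ ^ 2) =
      2 * inner ℝ (x - x') (q - q') := by
    simp only [norm_sub_sq_real, inner_sub_left, inner_sub_right, real_inner_comm]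
    simp only [real_inner_comm x']
    ring
  have h4 : r / 2 * (‖q' - x‖ ^ 2 - ‖q - x‖ ^ 2 + (‖q - x'‖ ^ 2 - ‖q' - x'‖ ^ 2)) =
      r * inner ℝ (x - x') (q - q') := by rw [h3]; ring
  linarith

theorem IsProxPoint.unique (hf : WeaklyConvexOn ρ Θ f) (hr : ρ < r) {x q q' : E}
    (hq : IsProxPoint f Θ (1 / r) x q) (hq' : IsProxPoint f Θ (1 / r) x q') : q = q' := by
  have h := hq.inner_ge hf hq'
  rw [sub_self, inner_zero_left, mul_zero] at h
  have h1 : ‖q - q'‖ ^ 2 = 0 := by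
    refine le_antisymm ?_ (sq_nonneg _)
    by_contra! h2
    linarith [mul_pos (sub_pos.2 hr) h2]
  exact sub_eq_zero.1 (norm_eq_zero.1 (pow_eq_zero_iff two_ne_zero |>.1 h1))

/-- The proximal map is `r / (r - ρ)`-Lipschitz. -/
theorem IsProxPoint.dist_le (hf : WeaklyConvexOn ρ Θ f) (hr : ρ < r) (hr0 : 0 ≤ r) {x q x' q' : E}
    (hq : IsProxPoint f Θ (1 / r) x q) (hq' : IsProxPoint f Θ (1 / r) x' q') :
    ‖q - q'‖ ≤ r / (r - ρ) * ‖x - x'‖ := by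
  have h := hq.inner_ge hf hq'
  have h1 := mul_le_mul_of_nonneg_left (real_inner_le_norm (x - x') (q - q')) hr0
  have hr1 := sub_pos.2 hr
  rw [div_mul_eq_mul_div, le_div_iff₀ hr1]
  rcases (norm_nonneg (q - q')).eq_or_lt with h0 | h0
  · rw [← h0]; simpa using mul_nonneg hr0 (norm_nonneg _)
  · refine le_of_mul_le_mul_right ?_ h0
    linarith

/-- The residual of the proximal map is nonexpansive if `2 ρ ≤ r`. -/
theorem IsProxPoint.residual_dist_le (hf : WeaklyConvexOn ρ Θ f) (hr : 2 * ρ ≤ r) (hr0 : 0 < r)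
    {x q x' q' : E} (hq : IsProxPoint f Θ (1 / r) x q) (hq' : IsProxPoint f Θ (1 / r) x' q') :
    ‖(x - q) - (x' - q')‖ ≤ ‖x - x'‖ := by
  have h := hq.inner_ge hf hq'
  have h1 : (x - q) - (x' - q') = (x - x') - (q - q') := by abel
  refine le_of_sq_le_sq ?_ (norm_nonneg _)
  rw [h1, norm_sub_sq_real]
  -- Here `2 ρ ≤ r` enters as `r / 2 ≤ r - ρ`, which makes the proximal map `1 / 2`-cocoercive.
  have h2 : r * ‖q - q'‖ ^ 2 ≤ r * (2 * inner ℝ (x - x') (q - q')) := by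
    nlinarith [sq_nonneg ‖q - q'‖]
  linarith [le_of_mul_le_mul_left h2 hr0]

section Envelope

variable {Pr : E → E}

omit [InnerProductSpace ℝ E] in
theorem moreauEnvelope_eq {x q : E} (hq : IsProxPoint f Θ (1 / r) x q) :
    moreauEnvelope f Θ (1 / r) x = f q + r / 2 * ‖q - x‖ ^ 2 := by
  have h2 : 1 / (2 * (1 / r)) = r / 2 := by rw [mul_one_div, one_div_div]
  have hm := (isProxPoint_iff.1 hq).2
  have : Nonempty Θ := ⟨⟨q, hq.1⟩⟩
  rw [moreauEnvelope, h2]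
  refine le_antisymm (ciInf_le ⟨f q + r / 2 * ‖q - x‖ ^ 2, ?_⟩ (⟨q, hq.1⟩ : Θ))
    (le_ciInf fun u => hm u u.2)
  rintro _ ⟨u, rfl⟩
  exact hm u u.2

omit [InnerProductSpace ℝ E] in
theorem moreauEnvelope_le (hPr : ∀ x, IsProxPoint f Θ (1 / r) x (Pr x)) (x : E) {u : E}
    (hu : u ∈ Θ) : moreauEnvelope f Θ (1 / r) x ≤ f u + r / 2 * ‖u - x‖ ^ 2 := by
  rw [moreauEnvelope_eq (hPr x)]
  exact (isProxPoint_iff.1 (hPr x)).2 u hu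

/-- The proximal point of `x` is a competitor in the infimum defining the envelope at `y`; expanding
the square gives the quadratic upper model. -/
theorem moreauEnvelope_le_add (hPr : ∀ x, IsProxPoint f Θ (1 / r) x (Pr x)) (x y : E) :
    moreauEnvelope f Θ (1 / r) y ≤ moreauEnvelope f Θ (1 / r) x +
      inner ℝ (r • (x - Pr x)) (y - x) + r / 2 * ‖y - x‖ ^ 2 := by
  have h := moreauEnvelope_le hPr y (hPr x).1
  rw [moreauEnvelope_eq (hPr x)]
  have h1 : Pr x - y = (Pr x - x) - (y - x) := by abel
  have h2 : x - Pr x = -(Pr x - x) := by abel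
  rw [h1, norm_sub_sq_real] at h
  rw [h2, real_inner_smul_left, inner_neg_left]
  linarith

/-- The gradient of the Moreau envelope is `r • (x - prox x)`. -/
theorem hasGradientAt_moreauEnvelope [CompleteSpace E] (hf : WeaklyConvexOn ρ Θ f)
    (hr : 2 * ρ ≤ r) (hr0 : 0 < r)
    (hPr : ∀ x, IsProxPoint f Θ (1 / r) x (Pr x)) (x : E) :
    HasGradientAt (moreauEnvelope f Θ (1 / r)) (r • (x - Pr x)) x := by
  have hbound : ∀ y, |moreauEnvelope f Θ (1 / r) y - moreauEnvelope f Θ (1 / r) x -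
      inner ℝ (r • (x - Pr x)) (y - x)| ≤ 2 * r * ‖y - x‖ ^ 2 := by
    intro y
    have h1 := moreauEnvelope_le_add hPr x y
    -- Exchanging `x` and `y` turns the upper model into a lower one, up to the inner product of the
    -- change of residual with `y - x`, which is quadratic by nonexpansiveness.
    have h2 := moreauEnvelope_le_add hPr y x
    have h3 := (hPr y).residual_dist_le hf hr hr0 (hPr x)
    have h4 := abs_real_inner_le_norm ((y - Pr y) - (x - Pr x)) (y - x)
    have h5 := (abs_le.1 (h4.trans (mul_le_mul_of_nonneg_right h3 (norm_nonneg _)))).1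
    rw [inner_sub_left] at h5
    rw [← neg_sub y x, inner_neg_right, norm_neg] at h2
    rw [real_inner_smul_left] at h1 h2 ⊢
    have h6 := mul_le_mul_of_nonneg_left h5 hr0.le
    have h7 : 0 ≤ r * ‖y - x‖ ^ 2 := by positivity
    rw [abs_le]
    constructor <;> nlinarith
  rw [hasGradientAt_iff_isLittleO]
  refine (Asymptotics.IsBigO.of_bound (2 * r) (g := fun y => ‖y - x‖ ^ 2)
    (Filter.Eventually.of_forall fun y => ?_)).trans_isLittleO ?_
  · simpa using hbound y
  · have h : (fun y : E => ‖y - x‖ ^ 2) =o[𝓝 x] fun y => ‖y - x‖ := by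
      have h0 : (fun y : E => ‖y - x‖) =o[𝓝 x] fun _ => (1 : ℝ) := by
        rw [Asymptotics.isLittleO_one_iff]
        have : Continuous fun y : E => ‖y - x‖ := by fun_prop
        simpa using this.tendsto x
      simpa [sq] using h0.mul_isBigO (Asymptotics.isBigO_refl (fun y : E => ‖y - x‖) (𝓝 x))
    exact h.norm_right.trans_isBigO (by simpa using Asymptotics.isBigO_refl _ _)

theorem norm_gradient_moreauEnvelope [CompleteSpace E] (hf : WeaklyConvexOn ρ Θ f)
    (hr : 2 * ρ ≤ r) (hr0 : 0 < r) (hPr : ∀ x, IsProxPoint f Θ (1 / r) x (Pr x)) (x : E) :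
    ‖gradient (moreauEnvelope f Θ (1 / r)) x‖ = r * ‖x - Pr x‖ := by
  rw [(hasGradientAt_moreauEnvelope hf hr hr0 hPr x).gradient, norm_smul,
    Real.norm_of_nonneg hr0.le]

omit [InnerProductSpace ℝ E] in
theorem bddBelow_moreauEnvelope (hr0 : 0 < r) (hbdd : BddBelow (f '' Θ))
    (hPr : ∀ x, IsProxPoint f Θ (1 / r) x (Pr x)) :
    BddBelow (Set.range (moreauEnvelope f Θ (1 / r))) := by
  obtain ⟨m, hm⟩ := hbdd
  refine ⟨m, ?_⟩
  rintro _ ⟨x, rfl⟩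
  rw [moreauEnvelope_eq (hPr x)]
  have h1 := hm ⟨Pr x, (hPr x).1, rfl⟩
  have h2 : 0 ≤ r / 2 * ‖Pr x - x‖ ^ 2 := by positivity
  linarith

omit [InnerProductSpace ℝ E] in
-- The envelope at `Pr x` is at most `f (Pr x)`, which lies below the envelope at `x` by exactly the
-- quadratic term.
theorem residual_sq_le_gap (hr0 : 0 < r) (hbdd : BddBelow (f '' Θ))
    (hPr : ∀ x, IsProxPoint f Θ (1 / r) x (Pr x)) (x : E) :
    r / 2 * ‖x - Pr x‖ ^ 2 ≤
      moreauEnvelope f Θ (1 / r) x - ⨅ y, moreauEnvelope f Θ (1 / r) y := by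
  have h1 := ciInf_le (bddBelow_moreauEnvelope hr0 hbdd hPr) (Pr x)
  have h2 := moreauEnvelope_le hPr (Pr x) (hPr x).1
  rw [moreauEnvelope_eq (hPr x), norm_sub_rev (Pr x) x]
  rw [sub_self, norm_zero] at h2
  linarith

end Envelope

section Subgradient

variable {g : E → E}

/-- Quadratic growth bounds `f u - f q` below by `(r - ρ / 2) ‖u - q‖ ^ 2`, while the subgradient at
`u` bounds it above by `L ‖u - q‖ + ρ / 2 ‖u - q‖ ^ 2`. -/
theorem residual_norm_le (hρ : 0 ≤ ρ) (hr : ρ < r) (hf : WeaklyConvexOn ρ Θ f)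
    (hL : 0 ≤ L) (hg : ∀ u ∈ Θ, g u ∈ subdifferential f u) (hgL : ∀ u ∈ Θ, ‖g u‖ ≤ L)
    {u q : E} (hu : u ∈ Θ) (hq : IsProxPoint f Θ (1 / r) u q) : ‖u - q‖ ≤ L / (r - ρ) := by
  have h1 := hq.quadratic_growth hf hu
  have h2 := hf.le_of_mem_subdifferential hρ hu hq.1 (hg u hu)
  have h3 := (abs_le.1 ((abs_real_inner_le_norm (g u) (q - u)).trans
    (mul_le_mul_of_nonneg_right (hgL u hu) (norm_nonneg _)))).1
  rw [norm_sub_rev q u] at *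
  rw [sub_self, norm_zero] at h1
  rw [le_div_iff₀ (sub_pos.2 hr)]
  rcases (norm_nonneg (u - q)).eq_or_lt with h0 | h0
  · rw [← h0]; simpa using hL
  · refine le_of_mul_le_mul_right ?_ h0
    nlinarith

/-- Bounded subgradients at both endpoints give a two-sided modulus. Continuity is what makes the
proximal minimum attained. -/
theorem continuousOn_of_subgradient (hρ : 0 ≤ ρ) (hf : WeaklyConvexOn ρ Θ f)
    (hg : ∀ u ∈ Θ, g u ∈ subdifferential f u) (hgL : ∀ u ∈ Θ, ‖g u‖ ≤ L) :
    ContinuousOn f Θ := by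
  intro u hu
  have key : ∀ v ∈ Θ, ∀ w ∈ Θ, f v - f w ≤ L * ‖v - w‖ + ρ / 2 * ‖v - w‖ ^ 2 := by
    intro v hv w hw
    have h2 := hf.le_of_mem_subdifferential hρ hv hw (hg v hv)
    have h3 := (abs_le.1 ((abs_real_inner_le_norm (g v) (w - v)).trans
      (mul_le_mul_of_nonneg_right (hgL v hv) (norm_nonneg _)))).1
    rw [norm_sub_rev w v] at *
    linarith
  rw [ContinuousWithinAt, tendsto_iff_norm_sub_tendsto_zero]
  have hlim : Tendsto (fun v => L * ‖v - u‖ + ρ / 2 * ‖v - u‖ ^ 2) (𝓝[Θ] u) (𝓝 0) := by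
    have : Continuous fun v => L * ‖v - u‖ + ρ / 2 * ‖v - u‖ ^ 2 := by fun_prop
    simpa using (this.tendsto u).mono_left nhdsWithin_le_nhds
  refine tendsto_of_tendsto_of_tendsto_of_le_of_le' tendsto_const_nhds hlim
    (Filter.Eventually.of_forall fun _ => norm_nonneg _) ?_
  filter_upwards [self_mem_nhdsWithin] with v hv
  rw [Real.norm_eq_abs, abs_le]
  have h1 := key v hv u hu
  have h2 := key u hu v hv
  rw [norm_sub_rev u v] at h2
  constructor <;> linarith

theorem exists_isProxPoint [ProperSpace E] (hρ : 0 ≤ ρ) (hr0 : 0 < r) (hf : WeaklyConvexOn ρ Θ f)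
    (hΘ : IsClosed Θ) (hne : Θ.Nonempty) (hbdd : BddBelow (f '' Θ))
    (hg : ∀ u ∈ Θ, g u ∈ subdifferential f u) (hgL : ∀ u ∈ Θ, ‖g u‖ ≤ L) (x : E) :
    ∃ q, IsProxPoint f Θ (1 / r) x q := by
  obtain ⟨m, hm⟩ := hbdd
  obtain ⟨u₀, hu₀⟩ := hne
  have hcont : ContinuousOn (fun u => f u + r / 2 * ‖u - x‖ ^ 2) Θ :=
    (continuousOn_of_subgradient hρ hf hg hgL).add (by fun_prop)
  have hcoer : ∀ᶠ u in cocompact E ⊓ 𝓟 Θ,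
      f u₀ + r / 2 * ‖u₀ - x‖ ^ 2 ≤ f u + r / 2 * ‖u - x‖ ^ 2 := by
    have h1 : Tendsto (fun u : E => m + r / 2 * ‖u - x‖ ^ 2) (cocompact E) atTop := by
      refine tendsto_atTop_add_const_left _ _ ?_
      refine Tendsto.const_mul_atTop (by positivity) ?_
      refine (tendsto_pow_atTop two_ne_zero).comp ?_
      have := tendsto_dist_right_cocompact_atTop x
      simpa [dist_eq_norm] using this
    have h2 := (h1.eventually_ge_atTop (f u₀ + r / 2 * ‖u₀ - x‖ ^ 2)).filter_mono
      (inf_le_left : cocompact E ⊓ 𝓟 Θ ≤ _)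
    have h3 : ∀ᶠ u in cocompact E ⊓ 𝓟 Θ, u ∈ Θ :=
      (inf_le_right : cocompact E ⊓ 𝓟 Θ ≤ _) (mem_principal_self _)
    filter_upwards [h2, h3] with u hu huΘ
    have := hm ⟨u, huΘ, rfl⟩
    linarith
  obtain ⟨q, hq, hmin⟩ := hcont.exists_isMinOn' hΘ hu₀ hcoer
  exact ⟨q, isProxPoint_iff.2 ⟨hq, fun u hu => hmin hu⟩⟩

omit [InnerProductSpace ℝ E] in
theorem isProxPoint_proxPoint {lam : ℝ} {x : E} (h : ∃ q, IsProxPoint f Θ lam x q) :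
    IsProxPoint f Θ lam x (proxPoint f Θ lam x) :=
  Classical.epsilon_spec h

/-- A fixed point of the proximal map is stationary when the subgradients are Lipschitz. -/
theorem mem_stationarySet_of_isProxPoint {L₁ : ℝ} (hρ : 0 ≤ ρ)
    (hf : WeaklyConvexOn ρ Θ f)
    (hg : ∀ u ∈ Θ, g u ∈ subdifferential f u)
    (hg_lip : ∀ u ∈ Θ, ∀ v ∈ Θ, ‖g u - g v‖ ≤ L₁ * ‖u - v‖) {u : E}
    (hu : IsProxPoint f Θ (1 / r) u u) : u ∈ stationarySet f Θ := by
  obtain ⟨huΘ, hmin⟩ := isProxPoint_iff.1 hu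
  refine ⟨huΘ, g u, hg u huΘ, fun v hv => ?_⟩
  rw [inner_neg_left, neg_nonpos]
  have key : ∀ s ∈ Set.Ioo (0 : ℝ) 1,
      0 ≤ inner ℝ (g u) (v - u) + s * ((L₁ + ρ / 2 + r / 2) * ‖v - u‖ ^ 2) := by
    intro s hs
    have hw := hf.1 huΘ hv (sub_nonneg.2 hs.2.le) hs.1.le (by ring)
    set w := (1 - s) • u + s • v
    have hd : w - u = s • (v - u) := by simp only [w]; module
    have h1 := hmin w hw
    -- The subgradient at `u` would bound `f w` from below, the wrong direction. The one at `w`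
    -- bounds `f w - f u` from above, and the Lipschitz bound carries it back to `u` at second order
    -- in `s`.
    have h2 := hf.le_of_mem_subdifferential hρ hw huΘ (hg w hw)
    have h3 := (real_inner_le_norm (g w - g u) (w - u)).trans
      (mul_le_mul_of_nonneg_right (hg_lip w hw u huΘ) (norm_nonneg _))
    rw [← neg_sub w u, inner_neg_right, norm_neg] at h2
    rw [inner_sub_left] at h3
    rw [hd, norm_smul, Real.norm_of_nonneg hs.1.le] at h1 h2 h3
    rw [real_inner_smul_right, real_inner_smul_right] at h3
    rw [real_inner_smul_right] at h2
    rw [sub_self, norm_zero] at h1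
    refine le_of_mul_le_mul_left ?_ hs.1
    linarith
  have hlim : Tendsto (fun s : ℝ =>
      inner ℝ (g u) (v - u) + s * ((L₁ + ρ / 2 + r / 2) * ‖v - u‖ ^ 2)) (𝓝[>] 0)
      (𝓝 (inner ℝ (g u) (v - u))) := by
    have : Continuous fun s : ℝ =>
      inner ℝ (g u) (v - u) + s * ((L₁ + ρ / 2 + r / 2) * ‖v - u‖ ^ 2) := by fun_prop
    simpa using (this.tendsto 0).mono_left (nhdsWithin_le_nhds (s := Set.Ioi (0 : ℝ)))
  exact ge_of_tendsto hlim (Filter.mem_of_superset (Ioo_mem_nhdsGT (zero_lt_one' ℝ)) key)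

end Subgradient

end Variational

/-! ### Recursions for increments and step sizes. -/

section RealSequences

variable {α δ : ℕ → ℝ} {β L a : ℝ}

theorem convex_comb_sq_le (hβ0 : 0 ≤ β) (hβ1 : β ≤ 1) {u b c : ℝ} (hu : 0 ≤ u)
    (h : u ≤ β * b + (1 - β) * c) : u ^ 2 ≤ β * b ^ 2 + (1 - β) * c ^ 2 := by
  have h1 : u ^ 2 ≤ (β * b + (1 - β) * c) ^ 2 := pow_le_pow_left₀ hu h 2
  nlinarith [mul_nonneg (mul_nonneg hβ0 (sub_nonneg.2 hβ1)) (sq_nonneg (b - c))]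

/-- Square summability of the increments of a contractive recursion. -/
theorem sum_sq_increment_le (hβ0 : 0 < β) (hβ1 : β ≤ 1) (hδ : ∀ t, 0 ≤ δ t)
    (h2 : δ 2 ≤ a) (hstep : ∀ t, 2 ≤ t → δ (t + 1) ≤ β * (α t * L) + (1 - β) * δ t) {T : ℕ}
    (hT : 2 ≤ T) :
    ∑ t ∈ Finset.Ico 2 T, δ t ^ 2 ≤ a ^ 2 / β + L ^ 2 * ∑ t ∈ Finset.Ico 2 T, α t ^ 2 := by
  have key : β * ∑ t ∈ Finset.Ico 2 T, δ t ^ 2 + δ T ^ 2 ≤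
      a ^ 2 + β * (L ^ 2 * ∑ t ∈ Finset.Ico 2 T, α t ^ 2) := by
    induction T, hT using Nat.le_induction with
    | base => simpa using pow_le_pow_left₀ (hδ 2) h2 2
    | succ t ht ih =>
      have h := convex_comb_sq_le hβ0.le hβ1 (hδ _) (hstep t ht)
      rw [Finset.sum_Ico_succ_top ht, Finset.sum_Ico_succ_top ht]
      linarith
  rw [div_add' _ _ _ hβ0.ne', le_div_iff₀ hβ0]
  nlinarith [sq_nonneg (δ T)]

/-- The initial error of a window of increments starting at `r`. -/
noncomputable def windowError (β a : ℝ) (δ : ℕ → ℝ) (r : ℕ) : ℝ :=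
  if r = 1 then a / β else (1 - β) / β * δ r

theorem window_sum_le_of_two_le (hβ0 : 0 < β) (hβ1 : β ≤ 1) (hL : 0 ≤ L) (hδ : ∀ t, 0 ≤ δ t)
    (hα : ∀ s t, 1 ≤ s → s ≤ t → α t ≤ α s)
    (hstep : ∀ t, 2 ≤ t → δ (t + 1) ≤ β * (α t * L) + (1 - β) * δ t) {r t : ℕ}
    (hr : 2 ≤ r) (hrt : r ≤ t) :
    ∑ i ∈ Finset.Ico r t, δ (i + 1) ≤ L * (((t : ℝ) - r) * α r) + (1 - β) / β * δ r := by
  have key : β * ∑ i ∈ Finset.Ico r t, δ (i + 1) + (1 - β) * δ t ≤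
      β * (L * (((t : ℝ) - r) * α r)) + (1 - β) * δ r := by
    induction t, hrt using Nat.le_induction with
    | base => simp
    | succ t ht ih =>
      have h := hstep t (hr.trans ht)
      have h1 : β * (L * α t) ≤ β * (L * α r) := by
        have := hα r t (one_le_two.trans hr) ht
        gcongr
      rw [Finset.sum_Ico_succ_top ht]
      push_cast
      linarith
  rw [div_mul_eq_mul_div, add_div' _ _ _ hβ0.ne', le_div_iff₀ hβ0]
  nlinarith [mul_nonneg (sub_nonneg.2 hβ1) (hδ t)]

/-- A window starting at `1` contains the increment `δ 2`, which comes from the arbitrary initial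
momentum and is known only through `a`. Together with the geometric tail it costs `δ 2 + (1 - β) / β
* δ 2 = δ 2 / β`. -/
theorem window_sum_le (hβ0 : 0 < β) (hβ1 : β ≤ 1) (hL : 0 ≤ L) (hδ : ∀ t, 0 ≤ δ t) (ha : 0 ≤ a)
    (hα0 : ∀ t, 1 ≤ t → 0 < α t) (hα : ∀ s t, 1 ≤ s → s ≤ t → α t ≤ α s) (h2 : δ 2 ≤ a)
    (hstep : ∀ t, 2 ≤ t → δ (t + 1) ≤ β * (α t * L) + (1 - β) * δ t) {r t : ℕ}
    (hr : 1 ≤ r) (hrt : r ≤ t) :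
    ∑ i ∈ Finset.Ico r t, δ (i + 1) ≤ L * (((t : ℝ) - r) * α r) + windowError β a δ r := by
  rcases hr.eq_or_lt with rfl | hr2
  · rw [windowError, if_pos rfl]
    rcases hrt.eq_or_lt with rfl | ht
    · simpa using div_nonneg ha hβ0.le
    · have h := window_sum_le_of_two_le hβ0 hβ1 hL hδ hα hstep le_rfl ht
      rw [Finset.sum_eq_sum_Ico_succ_bot ht]
      have h1 : δ 2 + (1 - β) / β * δ 2 ≤ a / β := by
        have : δ 2 + (1 - β) / β * δ 2 = δ 2 / β := by field_simp; ring
        rw [this]; gcongr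
      have h3 : ((t : ℝ) - 2) * α 2 ≤ ((t : ℝ) - 1) * α 1 := by
        have h4 : (2 : ℝ) ≤ t := by exact_mod_cast ht
        have h5 := hα 1 2 le_rfl one_le_two
        have h6 := hα0 1 le_rfl
        nlinarith
      have h7 := mul_le_mul_of_nonneg_left h3 hL
      push_cast at h ⊢
      linarith
  · rw [windowError, if_neg (by omega)]
    exact window_sum_le_of_two_le hβ0 hβ1 hL hδ hα hstep hr2 hrt

/-- Inserting a new largest index `t` adds `α t * (2 S + α t)` to the square of the old sum `S`. The
earlier indices are distinct integers strictly between `r` and `t`, so `2 S + α t ≤ 2 (t - r) b`.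
This bounds the total weight of all windows with the same start. -/
theorem sq_sum_le_two_mul_sum {F : Finset ℕ} {r : ℕ} {b : ℝ} (hb : 0 ≤ b) (hr : ∀ t ∈ F, r < t)
    (h0 : ∀ t ∈ F, 0 ≤ α t) (h1 : ∀ t ∈ F, α t ≤ b) :
    (∑ t ∈ F, α t) ^ 2 ≤ 2 * ∑ t ∈ F, ((t : ℝ) - r) * α t * b := by
  induction F using Finset.induction_on_max with
  | empty => simp
  | insert t F hF ih =>
    have ht : t ∉ F := fun h => lt_irrefl _ (hF t h)
    rw [Finset.sum_insert ht, Finset.sum_insert ht]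
    have ih' := ih (fun s hs => hr s (Finset.mem_insert_of_mem hs))
      (fun s hs => h0 s (Finset.mem_insert_of_mem hs))
      (fun s hs => h1 s (Finset.mem_insert_of_mem hs))
    have hcard : F.card + 1 + r ≤ t := by
      have h := Finset.card_le_card (fun s hs => Finset.mem_Ioo.2
        ⟨hr s (Finset.mem_insert_of_mem hs), hF s hs⟩ : F ⊆ Finset.Ioo r t)
      have := hr t (Finset.mem_insert_self _ _)
      rw [Nat.card_Ioo] at h
      omega
    have hcard' : (F.card : ℝ) + 1 + r ≤ t := by exact_mod_cast hcard
    have hsum : ∑ s ∈ F, α s ≤ F.card * b := by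
      simpa using Finset.sum_le_card_nsmul F α b fun s hs => h1 s (Finset.mem_insert_of_mem hs)
    have h3 : 2 * ∑ s ∈ F, α s + α t ≤ 2 * (((t : ℝ) - r) * b) := by
      have h4 := h1 t (Finset.mem_insert_self _ _)
      nlinarith [mul_le_mul_of_nonneg_right hcard' hb]
    have h5 := mul_le_mul_of_nonneg_left h3 (h0 t (Finset.mem_insert_self _ _))
    nlinarith

/-- Grouping the windows by their start `i` charges each `D i` only once. With `A` the weight of the
group, Young's inequality gives `L A D ≤ 3/2 L ^ 2 A ^ 2 + D ^ 2 / 6`, and the preceding lemma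
bounds `A ^ 2`. -/
theorem sum_mul_windowError_le {r : ℕ → ℕ} {T : ℕ} {D : ℕ → ℝ}
    (hα0 : ∀ t, 1 ≤ t → 0 < α t) (hα : ∀ s t, 1 ≤ s → s ≤ t → α t ≤ α s)
    (hr : ∀ t ∈ Finset.Icc 2 T, 1 ≤ r t ∧ r t < t) :
    L * ∑ t ∈ Finset.Icc 2 T, α t * D (r t) ≤
      3 * L ^ 2 * ∑ t ∈ Finset.Icc 2 T, ((t : ℝ) - r t) * α t * α (r t) +
        1 / 6 * ∑ i ∈ Finset.Icc 1 T, D i ^ 2 := by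
  have hmaps : ∀ t ∈ Finset.Icc 2 T, r t ∈ Finset.Icc 1 T := fun t ht => by
    have := hr t ht
    rw [Finset.mem_Icc] at ht ⊢
    omega
  rw [← Finset.sum_fiberwise_of_maps_to hmaps (fun t => α t * D (r t)),
    ← Finset.sum_fiberwise_of_maps_to hmaps (fun t => ((t : ℝ) - r t) * α t * α (r t)),
    Finset.mul_sum, Finset.mul_sum, Finset.mul_sum, ← Finset.sum_add_distrib]
  refine Finset.sum_le_sum fun i hi => ?_
  have hi1 := (Finset.mem_Icc.1 hi).1
  have e1 : ∑ t ∈ Finset.Icc 2 T with r t = i, α t * D (r t) =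
      (∑ t ∈ Finset.Icc 2 T with r t = i, α t) * D i := by
    rw [Finset.sum_mul]
    exact Finset.sum_congr rfl fun t ht => by rw [(Finset.mem_filter.1 ht).2]
  have e2 : ∑ t ∈ Finset.Icc 2 T with r t = i, ((t : ℝ) - r t) * α t * α (r t) =
      ∑ t ∈ Finset.Icc 2 T with r t = i, ((t : ℝ) - i) * α t * α i :=
    Finset.sum_congr rfl fun t ht => by rw [(Finset.mem_filter.1 ht).2]
  have h3 := sq_sum_le_two_mul_sum (α := α) (F := (Finset.Icc 2 T).filter (r · = i)) (r := i)
    (hα0 i hi1).le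
    (fun t ht => by
      obtain ⟨h, rfl⟩ := Finset.mem_filter.1 ht
      exact (hr t h).2)
    (fun t ht => (hα0 t (one_le_two.trans
      (Finset.mem_Icc.1 (Finset.mem_filter.1 ht).1).1)).le)
    (fun t ht => by
      obtain ⟨h, rfl⟩ := Finset.mem_filter.1 ht
      exact hα _ _ (hr t h).1 (hr t h).2.le)
  rw [e1, e2]
  set A := ∑ t ∈ Finset.Icc 2 T with r t = i, α t
  nlinarith [sq_nonneg (3 * (L * A) - D i), mul_le_mul_of_nonneg_left h3 (sq_nonneg L)]

theorem sum_sq_windowError_le (hβ0 : 0 < β) {T : ℕ} (hT : 1 ≤ T) (hβ1 : β ≤ 1)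
    (hδ : ∀ t, 0 ≤ δ t) (h2 : δ 2 ≤ a)
    (hstep : ∀ t, 2 ≤ t → δ (t + 1) ≤ β * (α t * L) + (1 - β) * δ t) :
    ∑ i ∈ Finset.Icc 1 T, windowError β a δ i ^ 2 ≤ a ^ 2 / β ^ 2 + ((1 - β) / β) ^ 2 *
      (a ^ 2 / β + L ^ 2 * ∑ t ∈ Finset.Icc 1 T, α t ^ 2) := by
  have hI : Finset.Icc 1 T = Finset.Ico 1 (T + 1) := by ext; simp
  have hT2 : 2 ≤ T + 1 := by omega
  have h := sum_sq_increment_le hβ0 hβ1 hδ h2 hstep hT2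
  rw [hI, Finset.sum_eq_sum_Ico_succ_bot (by omega), windowError, if_pos rfl,
    Finset.sum_eq_sum_Ico_succ_bot (by omega) (fun t => α t ^ 2)]
  have e : ∑ i ∈ Finset.Ico (1 + 1) (T + 1), windowError β a δ i ^ 2 =
      ((1 - β) / β) ^ 2 * ∑ i ∈ Finset.Ico 2 (T + 1), δ i ^ 2 := by
    rw [Finset.mul_sum]
    refine Finset.sum_congr rfl fun i hi => ?_
    rw [windowError, if_neg (by have := (Finset.mem_Ico.1 hi).1; omega), mul_pow]
  rw [e, div_pow]
  have h3 := mul_le_mul_of_nonneg_left h (sq_nonneg ((1 - β) / β))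
  have h4 : 0 ≤ ((1 - β) / β) ^ 2 * (L ^ 2 * α 1 ^ 2) := by positivity
  norm_num at *
  linarith

theorem sum_Icc_pred_le {F : ℕ → ℝ} (hF : ∀ t, 1 ≤ t → 0 ≤ F t) (T : ℕ) :
    ∑ t ∈ Finset.Icc 2 T, F (t - 1) ≤ ∑ t ∈ Finset.Icc 1 T, F t := by
  have hinj : Set.InjOn (fun t : ℕ => t - 1) (Finset.Icc 2 T) := by
    intro s hs t ht hst
    simp only [Finset.coe_Icc, Set.mem_Icc] at hs ht
    simp only at hst
    omega
  rw [← Finset.sum_image (f := F) hinj]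
  refine Finset.sum_le_sum_of_subset_of_nonneg (fun s hs => ?_)
    fun t ht _ => hF t (Finset.mem_Icc.1 ht).1
  obtain ⟨t, ht, rfl⟩ := Finset.mem_image.1 hs
  rw [Finset.mem_Icc] at ht ⊢
  omega

/-- The windows of increments, weighted by the step sizes, are controlled by the step sizes. -/
theorem sum_mul_window_le (hβ0 : 0 < β) (hβ1 : β ≤ 1) (hL : 0 ≤ L) (hδ : ∀ t, 0 ≤ δ t)
    (ha : 0 ≤ a)
    (hα0 : ∀ t, 1 ≤ t → 0 < α t) (hα : ∀ s t, 1 ≤ s → s ≤ t → α t ≤ α s) (h2 : δ 2 ≤ a)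
    (hstep : ∀ t, 2 ≤ t → δ (t + 1) ≤ β * (α t * L) + (1 - β) * δ t) {k : ℕ → ℕ}
    (hk : ∀ t, 1 ≤ t → 1 ≤ k t ∧ k t ≤ t) {T : ℕ} (hT : 1 ≤ T) :
    L * ∑ t ∈ Finset.Icc 2 T, α t * ∑ i ∈ Finset.Ico (t - k (t - 1)) t, δ (i + 1) ≤
      4 * L ^ 2 * ∑ t ∈ Finset.Icc 1 T, (k t : ℝ) * α t * α (max 1 (t - k t)) +
        1 / 6 * (a ^ 2 / β ^ 2 + ((1 - β) / β) ^ 2 *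
          (a ^ 2 / β + L ^ 2 * ∑ t ∈ Finset.Icc 1 T, α t ^ 2)) := by
  have hr : ∀ t ∈ Finset.Icc 2 T, 1 ≤ t - k (t - 1) ∧ t - k (t - 1) < t := fun t ht => by
    have h := (Finset.mem_Icc.1 ht).1
    have := hk (t - 1) (by omega)
    omega
  have h1 := sum_mul_windowError_le (L := L) (D := windowError β a δ) hα0 hα hr
  have h3 := sum_sq_windowError_le hβ0 hT hβ1 hδ h2 hstep
  have h4 : L * ∑ t ∈ Finset.Icc 2 T, α t * ∑ i ∈ Finset.Ico (t - k (t - 1)) t, δ (i + 1) ≤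
      L ^ 2 * ∑ t ∈ Finset.Icc 2 T,
        ((t : ℝ) - (t - k (t - 1) : ℕ)) * α t * α (t - k (t - 1)) +
      L * ∑ t ∈ Finset.Icc 2 T, α t * windowError β a δ (t - k (t - 1)) := by
    rw [sq, mul_assoc, ← mul_add]
    refine mul_le_mul_of_nonneg_left ?_ hL
    rw [Finset.mul_sum, ← Finset.sum_add_distrib]
    refine Finset.sum_le_sum fun t ht => ?_
    have h := window_sum_le hβ0 hβ1 hL hδ ha hα0 hα h2 hstep (hr t ht).1 (hr t ht).2.le
    have := mul_le_mul_of_nonneg_left h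
      (hα0 t (one_le_two.trans (Finset.mem_Icc.1 ht).1)).le
    linarith
  -- The window ending at `t` has length `k (t - 1)`, so it is compared with the summand of index `t
  -- - 1`. Its start is one more than `t - 1 - k (t - 1)`; `max 1` encodes the convention `α_0 =
  -- α_1`.
  have h5 : ∑ t ∈ Finset.Icc 2 T, ((t : ℝ) - (t - k (t - 1) : ℕ)) * α t * α (t - k (t - 1)) ≤
      ∑ t ∈ Finset.Icc 1 T, (k t : ℝ) * α t * α (max 1 (t - k t)) := by
    refine le_trans (Finset.sum_le_sum fun t ht => ?_) (sum_Icc_pred_le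
      (F := fun t => (k t : ℝ) * α t * α (max 1 (t - k t))) (fun t ht1 => ?_) T)
    · have ht2 := (Finset.mem_Icc.1 ht).1
      have hkt := hk (t - 1) (by omega)
      have hcast : (t : ℝ) - (t - k (t - 1) : ℕ) = k (t - 1) := by
        rw [Nat.cast_sub (by omega)]; ring
      rw [hcast]
      have h6 := hα (t - 1) t (by omega) (by omega)
      have h7 := hα (max 1 (t - 1 - k (t - 1))) (t - k (t - 1)) (le_max_left _ _) (by omega)
      have h8 := (hα0 t (by omega)).le
      have h9 := (hα0 (t - 1) (by omega)).le
      have h10 := (hα0 (t - k (t - 1)) (by omega)).le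
      gcongr
    · have h8 := (hα0 t ht1).le
      have h9 := (hα0 (max 1 (t - k t)) (le_max_left _ _)).le
      positivity
  nlinarith [mul_le_mul_of_nonneg_left h5 (sq_nonneg L)]

theorem increment_le (hβ0 : 0 < β) (hβ1 : β ≤ 1) (hL : 0 ≤ L)
    (hα0 : ∀ t, 1 ≤ t → 0 < α t) (hα : ∀ s t, 1 ≤ s → s ≤ t → α t ≤ α s) (h1 : δ 1 = 0)
    (ha : 0 ≤ a) (h2 : δ 2 ≤ a)
    (hstep : ∀ t, 2 ≤ t → δ (t + 1) ≤ β * (α t * L) + (1 - β) * δ t) {t : ℕ} (ht : 1 ≤ t) :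
    δ t ≤ a + α 1 * L := by
  have hα1 := (hα0 1 le_rfl).le
  rcases ht.eq_or_lt with rfl | ht2
  · rw [h1]; positivity
  · clear ht
    change 2 ≤ t at ht2
    induction t, ht2 using Nat.le_induction with
    | base => exact h2.trans (le_add_of_nonneg_right (by positivity))
    | succ t ht ih =>
      have h := hstep t ht
      have h3 : β * (α t * L) ≤ β * (a + α 1 * L) := by
        have h4 := hα 1 t le_rfl (by omega)
        have : α t * L ≤ α 1 * L := by gcongr
        gcongr; linarith
      have h5 := mul_le_mul_of_nonneg_left ih (sub_nonneg.2 hβ1)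
      linarith

/-- If consecutive step sizes are asymptotically equal, the increments are of the order of the
step sizes. -/
theorem exists_increment_le_mul (hβ0 : 0 < β) (hβ1 : β ≤ 1) (hL : 0 ≤ L)
    (hα0 : ∀ t, 1 ≤ t → 0 < α t)
    (hstep : ∀ t, 2 ≤ t → δ (t + 1) ≤ β * (α t * L) + (1 - β) * δ t)
    (hratio : Tendsto (fun t => α t / α (t + 1)) atTop (𝓝 1)) :
    ∃ C, 0 ≤ C ∧ ∀ᶠ t in atTop, δ t ≤ C * α t := by
  -- The induction will produce `(β / 2 + 1 - β) C α t = (1 - β / 2) C α t` because `L ≤ C / 2`;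
  -- this makes it at most `C α (t + 1)`.
  have h1 : ∀ᶠ t in atTop, α t / α (t + 1) * (1 - β / 2) < 1 := by
    have : Tendsto (fun t => α t / α (t + 1) * (1 - β / 2)) atTop (𝓝 (1 * (1 - β / 2))) :=
      hratio.mul_const _
    exact this.eventually_lt_const (by linarith)
  obtain ⟨N, hN⟩ := eventually_atTop.1 h1
  set M := max N 2
  have hM2 : 2 ≤ M := le_max_right _ _
  refine ⟨max (2 * L) (δ M / α M), le_max_of_le_left (by positivity),
    eventually_atTop.2 ⟨M, fun t ht => ?_⟩⟩
  set C := max (2 * L) (δ M / α M)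
  have hC : 0 ≤ C := le_max_of_le_left (by positivity)
  induction t, ht using Nat.le_induction with
  | base =>
    rw [← div_le_iff₀ (hα0 M (by omega))]
    exact le_max_right _ _
  | succ t ht ih =>
    have h := hstep t (hM2.trans ht)
    have h3 := hN t ((le_max_left _ _).trans ht)
    have hα1 := hα0 (t + 1) (by omega)
    have hαt := hα0 t (by omega)
    rw [div_mul_eq_mul_div, div_lt_one hα1] at h3
    have h4 : L ≤ C / 2 := by linarith [le_max_left (2 * L) (δ M / α M)]
    have h5 : β * (α t * L) ≤ β * (α t * (C / 2)) := by gcongr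
    have h6 := mul_le_mul_of_nonneg_left ih (sub_nonneg.2 hβ1)
    have h7 := mul_le_mul_of_nonneg_left h3.le hC
    linarith

/-- A nonnegative sequence with increments of the order of the step sizes, whose squares are
summable against the step sizes, tends to zero if the step sizes are not summable. -/
theorem tendsto_zero_of_summable_mul_sq {b : ℕ → ℝ} {C : ℝ} (hb : ∀ t, 0 ≤ b t) (hC : 0 ≤ C)
    (hα0 : ∀ t, 0 ≤ α t)
    (hαdiv : ¬ Summable α) (hsum : Summable fun t => α t * b t ^ 2)
    (hsum' : Summable fun t => α t * b (t + 1) ^ 2)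
    (hinc : ∀ t, |b (t + 1) - b t| ≤ C * α t) : Tendsto b atTop (𝓝 0) := by
  -- The difference of cubes is the increment, of order `α t`, times a quadratic form in consecutive
  -- values, so the cubes have summable increments. A positive limit would then force `α` to be
  -- summable.
  have hcube : ∀ t, dist (b t ^ 3) (b (t + 1) ^ 3) ≤
      3 / 2 * C * (α t * b t ^ 2 + α t * b (t + 1) ^ 2) := by
    intro t
    have e : b t ^ 3 - b (t + 1) ^ 3 =
        (b t - b (t + 1)) * (b t ^ 2 + b t * b (t + 1) + b (t + 1) ^ 2) := by ring
    have h0 : 0 ≤ b t ^ 2 + b t * b (t + 1) + b (t + 1) ^ 2 := by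
      have := hb t; have := hb (t + 1); positivity
    rw [Real.dist_eq, e, abs_mul, abs_of_nonneg h0, abs_sub_comm]
    have h1 := mul_le_mul_of_nonneg_right (hinc t) h0
    have h2 : b t ^ 2 + b t * b (t + 1) + b (t + 1) ^ 2 ≤ 3 / 2 * (b t ^ 2 + b (t + 1) ^ 2) := by
      nlinarith [sq_nonneg (b t - b (t + 1))]
    have h3 := mul_le_mul_of_nonneg_left h2 (mul_nonneg hC (hα0 t))
    linarith
  have hcau : CauchySeq fun t => b t ^ 3 :=
    cauchySeq_of_dist_le_of_summable _ hcube ((hsum.add hsum').mul_left _)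
  obtain ⟨l, hl⟩ := cauchySeq_tendsto_of_complete hcau
  have hl0 : 0 ≤ l := ge_of_tendsto' hl fun t => pow_nonneg (hb t) 3
  have hbl : l = 0 := by
    by_contra hne
    have hpos : 0 < l := lt_of_le_of_ne hl0 (Ne.symm hne)
    set c := min (l / 2) 1
    have hc0 : 0 < c := lt_min (by positivity) one_pos
    have hev : ∀ᶠ t in atTop, c < b t := by
      filter_upwards [hl.eventually_const_lt (by linarith : l / 2 < l)] with t ht
      by_contra! h
      have h1 : b t ^ 3 ≤ c ^ 3 := pow_le_pow_left₀ (hb t) h 3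
      have h2 : c ^ 3 ≤ c := by
        have := pow_le_of_le_one hc0.le (min_le_right _ _) (n := 3) (by norm_num)
        exact this
      linarith [min_le_left (l / 2) 1]
    apply hαdiv
    have h1 : Summable fun t => (c ^ 2)⁻¹ * (α t * b t ^ 2) := hsum.mul_left _
    refine summable_of_isBigO_nat h1 (Asymptotics.IsBigO.of_bound 1 ?_)
    filter_upwards [hev] with t ht
    have h3 : c ^ 2 ≤ b t ^ 2 := pow_le_pow_left₀ hc0.le ht.le 2
    have h0 := hα0 t
    rw [Real.norm_of_nonneg h0, Real.norm_of_nonneg (by positivity), one_mul,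
      inv_mul_eq_div, le_div_iff₀ (by positivity)]
    gcongr
  rw [hbl] at hl
  have h := hl.rpow_const (p := 1 / 3) (Or.inr (by norm_num))
  rw [Real.zero_rpow (by norm_num)] at h
  refine h.congr fun t => ?_
  rw [← Real.rpow_natCast, ← Real.rpow_mul (hb t)]
  norm_num

end RealSequences

/-! ### Projections onto a convex set. -/

section Projection

variable {E : Type*} [NormedAddCommGroup E] [InnerProductSpace ℝ E] {Θ : Set E}

theorem IsProjOnto.inner_le_zero (hΘ : Convex ℝ Θ) {y q u : E} (hq : IsProjOnto Θ y q)
    (hu : u ∈ Θ) : inner ℝ (y - q) (u - q) ≤ 0 := by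
  refine (norm_eq_iInf_iff_real_inner_le_zero hΘ hq.1).1 ?_ u hu
  have : Nonempty Θ := ⟨⟨q, hq.1⟩⟩
  exact le_antisymm (le_ciInf fun w => hq.2 w w.2)
    (ciInf_le ⟨0, by rintro _ ⟨w, rfl⟩; exact norm_nonneg _⟩ (⟨q, hq.1⟩ : Θ))

theorem IsProjOnto.norm_sub_le (hΘ : Convex ℝ Θ) {y q u : E} (hq : IsProjOnto Θ y q)
    (hu : u ∈ Θ) : ‖q - u‖ ≤ ‖y - u‖ := by
  have h := hq.inner_le_zero hΘ hu
  have e : y - u = (y - q) - (u - q) := by abel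
  refine le_of_sq_le_sq ?_ (norm_nonneg _)
  rw [norm_sub_rev q u, e, norm_sub_sq_real (y - q)]
  nlinarith [sq_nonneg ‖y - q‖]

/-- An extrapolated projection step is nonexpansive towards the constraint set. -/
theorem IsProjOnto.extrapolate_norm_le (hΘ : Convex ℝ Θ) {β η : ℝ} (hβ0 : 0 < β) (hβ1 : β ≤ 1)
    {w v q u : E} (hw : w ∈ Θ) (hq : IsProjOnto Θ (w - η • v) q) (hu : u ∈ Θ) :
    ‖q + ((1 - β) / β) • (q - w) - u‖ ≤ ‖w - (η / β) • v - u‖ := by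
  have h1 := hq.inner_le_zero hΘ hu
  have h2 := hq.inner_le_zero hΘ hw
  set d := w - η • v - q
  -- The vector `d` removed by the projection is normal to `Θ` at `q`. The unprojected point exceeds
  -- the extrapolated one by `β⁻¹ • d`, and normality against both `u` and `w` makes the cross term
  -- nonnegative.
  have e : w - (η / β) • v - u = (q + ((1 - β) / β) • (q - w) - u) + β⁻¹ • d := by
    simp only [d]
    have : (1 - β) / β = β⁻¹ - 1 := by field_simp
    rw [this, div_eq_inv_mul]
    module
  have e2 : q + ((1 - β) / β) • (q - w) - u = -((u - q) + ((1 - β) / β) • (w - q)) := by module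
  have h3 : 0 ≤ inner ℝ (q + ((1 - β) / β) • (q - w) - u) (β⁻¹ • d) := by
    rw [e2, inner_neg_left, inner_add_left, real_inner_smul_left, real_inner_smul_right,
      real_inner_smul_right, real_inner_comm, real_inner_comm d (w - q)]
    have h4 : 0 ≤ (1 - β) / β := div_nonneg (sub_nonneg.2 hβ1) hβ0.le
    have h5 : 0 ≤ β⁻¹ := by positivity
    have h6 := mul_nonneg h5 (neg_nonneg.2 h1)
    have h7 := mul_nonneg h4 (mul_nonneg h5 (neg_nonneg.2 h2))
    linarith
  refine le_of_sq_le_sq ?_ (norm_nonneg _)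
  rw [e, norm_add_sq_real]
  nlinarith [sq_nonneg ‖β⁻¹ • d‖]

end Projection

/-! ### Deterministic estimates along one path. -/

section Pathwise

variable {E Ω X : Type*} [NormedAddCommGroup E] [InnerProductSpace ℝ E]

/-- The standing assumptions of the projected stochastic heavy ball method, with the mean
subgradient `g` and the proximal map `Pr` made explicit. -/
structure HeavyBallModel (f : E → ℝ) (Θ : Set E) (G : E → X → E) (g Pr : E → E)
    (ρ r L L₁ : ℝ) (α : ℕ → ℝ) (β : ℝ) : Prop where
  rho_pos : 0 < ρ
  two_rho_le : 2 * ρ ≤ r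
  L_pos : 0 < L
  L₁_pos : 0 < L₁
  convex : Convex ℝ Θ
  weaklyConvex : WeaklyConvexOn ρ Θ f
  bddBelow : BddBelow (f '' Θ)
  prox : ∀ x, IsProxPoint f Θ (1 / r) x (Pr x)
  mem_subdifferential : ∀ u ∈ Θ, g u ∈ subdifferential f u
  norm_g_le : ∀ u ∈ Θ, ‖g u‖ ≤ L
  g_lip : ∀ u ∈ Θ, ∀ v ∈ Θ, ‖g u - g v‖ ≤ L₁ * ‖u - v‖
  G_lip : ∀ y, ∀ u ∈ Θ, ∀ v ∈ Θ, ‖G u y - G v y‖ ≤ L₁ * ‖u - v‖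
  norm_G_le : ∀ u ∈ Θ, ∀ y, ‖G u y‖ ≤ L
  α_pos : ∀ t, 1 ≤ t → 0 < α t
  α_anti : ∀ s t, 1 ≤ s → s ≤ t → α t ≤ α s
  β_pos : 0 < β
  β_le : β ≤ 1

/-- The inner product of the stochastic error with the proximal residual. -/
def noiseTerm (G : E → X → E) (g Pr : E → E) (u : E) (y : X) : ℝ :=
  inner ℝ (G u y - g u) (u - Pr u)

variable {f : E → ℝ} {Θ : Set E} {G : E → X → E} {g Pr : E → E} {ρ r L L₁ : ℝ} {α : ℕ → ℝ} {β : ℝ}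

namespace HeavyBallModel

variable (M : HeavyBallModel f Θ G g Pr ρ r L L₁ α β)
include M

theorem rho_lt : ρ < r := by linarith [M.rho_pos, M.two_rho_le]

theorem r_pos : 0 < r := M.rho_pos.trans M.rho_lt

theorem residual_le {u : E} (hu : u ∈ Θ) : ‖u - Pr u‖ ≤ L / (r - ρ) :=
  residual_norm_le M.rho_pos.le M.rho_lt M.weaklyConvex M.L_pos.le M.mem_subdifferential
    M.norm_g_le hu (M.prox u)

theorem residual_lip (u v : E) : ‖(u - Pr u) - (v - Pr v)‖ ≤ ‖u - v‖ :=
  (M.prox u).residual_dist_le M.weaklyConvex M.two_rho_le M.r_pos (M.prox v)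

theorem prox_lip (u v : E) : ‖Pr u - Pr v‖ ≤ 2 * ‖u - v‖ := by
  refine ((M.prox u).dist_le M.weaklyConvex M.rho_lt M.r_pos.le (M.prox v)).trans ?_
  refine mul_le_mul_of_nonneg_right ?_ (norm_nonneg _)
  rw [div_le_iff₀ (sub_pos.2 M.rho_lt)]
  linarith [M.two_rho_le]

theorem norm_sub_g_le {u : E} (hu : u ∈ Θ) (y : X) : ‖G u y - g u‖ ≤ 2 * L := by
  linarith [norm_sub_le (G u y) (g u), M.norm_G_le u hu y, M.norm_g_le u hu]

/-- Changing the first factor costs `2 L₁ * L / (r - ρ)`, changing the residual costs `2 L`. The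
latter is enlarged by `1 ≤ r / (r - ρ)` to obtain a common denominator. -/
theorem noiseTerm_lip {u v : E} (hu : u ∈ Θ) (hv : v ∈ Θ) (y : X) :
    noiseTerm G g Pr v y - 2 * L * (L₁ + r) / (r - ρ) * ‖u - v‖ ≤ noiseTerm G g Pr u y := by
  have hrρ := sub_pos.2 M.rho_lt
  have hL := M.L_pos
  have hL₁ := M.L₁_pos
  have e : noiseTerm G g Pr u y - noiseTerm G g Pr v y =
      inner ℝ ((G u y - G v y) - (g u - g v)) (u - Pr u) +
      inner ℝ (G v y - g v) ((u - Pr u) - (v - Pr v)) := by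
    simp only [noiseTerm, inner_sub_left, inner_sub_right]; ring
  have h1 : ‖(G u y - G v y) - (g u - g v)‖ ≤ 2 * L₁ * ‖u - v‖ := by
    linarith [norm_sub_le (G u y - G v y) (g u - g v), M.G_lip y u hu v hv, M.g_lip u hu v hv]
  have h2 := (abs_le.1 ((abs_real_inner_le_norm _ _).trans
    (mul_le_mul h1 (M.residual_le hu) (norm_nonneg _) (by positivity)))).1
  have h3 := (abs_le.1 ((abs_real_inner_le_norm _ _).trans
    (mul_le_mul (M.norm_sub_g_le hv y) (M.residual_lip u v) (norm_nonneg _) (by positivity)))).1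
  have h4 : 2 * L * ‖u - v‖ ≤ 2 * L * (r / (r - ρ)) * ‖u - v‖ := by
    have : 1 ≤ r / (r - ρ) := by rw [le_div_iff₀ hrρ]; linarith [M.rho_pos]
    have h0 : 0 ≤ 2 * L * ‖u - v‖ := by positivity
    nlinarith
  have e2 : 2 * L * (L₁ + r) / (r - ρ) * ‖u - v‖ =
      2 * L₁ * ‖u - v‖ * (L / (r - ρ)) + 2 * L * (r / (r - ρ)) * ‖u - v‖ := by ring
  linarith

/-- Quadratic growth at the proximal point of `b`, tested with `u`, is added to the subgradient
inequality from `u` to `Pr b`. The leftover `(r - 2 ρ) / 2 * ‖u - Pr b‖ ^ 2` is dropped. -/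
theorem inner_g_residual_ge {u : E} (hu : u ∈ Θ) (b : E) :
    r / 2 * ‖b - Pr b‖ ^ 2 - r / 2 * ‖b - u‖ ^ 2 ≤ inner ℝ (g u) (u - Pr b) := by
  have h1 := (M.prox b).quadratic_growth M.weaklyConvex hu
  have h2 := M.weaklyConvex.le_of_mem_subdifferential M.rho_pos.le hu (M.prox b).1
    (M.mem_subdifferential u hu)
  rw [← neg_sub u (Pr b), inner_neg_right, norm_neg] at h2
  rw [norm_sub_rev (Pr b) b, norm_sub_rev u b] at h1
  have h3 := M.two_rho_le
  nlinarith [sq_nonneg ‖u - Pr b‖]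

/-- One step of the descent of the Moreau envelope. -/
theorem descent {u v b b' : E} {η α₁ : ℝ} (hη : 0 ≤ η) (hηα : η ≤ α₁) (hu : u ∈ Θ) {y : X}
    (hv : v = G u y) (hb : ‖b' - Pr b‖ ≤ ‖b - η • v - Pr b‖) :
    η * (r * ‖b - Pr b‖) ^ 2 ≤
      2 * (moreauEnvelope f Θ (1 / r) b - moreauEnvelope f Θ (1 / r) b') +
        r * (6 * L ^ 2 * η ^ 2 + (5 + r * α₁) * ‖b - u‖ ^ 2 - 2 * η * noiseTerm G g Pr u y) := by
  have hr := M.r_pos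
  have hL := M.L_pos
  have hvL : ‖v‖ ≤ L := hv ▸ M.norm_G_le u hu y
  have h1 := moreauEnvelope_le M.prox b' (M.prox b).1
  have h2 : ‖Pr b - b'‖ ^ 2 ≤
      ‖b - Pr b‖ ^ 2 - 2 * (η * inner ℝ v (b - Pr b)) + η ^ 2 * L ^ 2 := by
    rw [norm_sub_rev]
    refine (pow_le_pow_left₀ (norm_nonneg _) hb 2).trans ?_
    have e : b - η • v - Pr b = (b - Pr b) - η • v := by abel
    rw [e, norm_sub_sq_real, real_inner_smul_right, real_inner_comm, norm_smul, mul_pow,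
      Real.norm_eq_abs, sq_abs]
    have := pow_le_pow_left₀ (norm_nonneg v) hvL 2
    nlinarith [sq_nonneg η]
  have h3 := moreauEnvelope_eq (M.prox b)
  rw [norm_sub_rev] at h3
  -- The noise is isolated at `u`, not at `b`. The two mismatch terms cost `L` and `2 L * 2` times
  -- `‖b - u‖`, hence `5 L`.
  have e : inner ℝ v (b - Pr b) = inner ℝ v (b - u) + noiseTerm G g Pr u y +
      inner ℝ (v - g u) (Pr u - Pr b) + inner ℝ (g u) (u - Pr b) := by
    rw [hv]
    simp only [noiseTerm, inner_sub_left, inner_sub_right]; ring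
  have h4 := (abs_le.1 ((abs_real_inner_le_norm v (b - u)).trans
    (mul_le_mul_of_nonneg_right hvL (norm_nonneg _)))).1
  have h5 := (abs_le.1 ((abs_real_inner_le_norm (v - g u) (Pr u - Pr b)).trans
    (mul_le_mul (hv ▸ M.norm_sub_g_le hu y) (M.prox_lip u b) (norm_nonneg _)
      (by positivity)))).1
  rw [norm_sub_rev u b] at h5
  have h6 := M.inner_g_residual_ge hu b
  have h7 : r / 2 * ‖b - Pr b‖ ^ 2 ≤ inner ℝ v (b - Pr b) + 5 * L * ‖b - u‖ +
      r / 2 * ‖b - u‖ ^ 2 - noiseTerm G g Pr u y := by linarith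
  have h8 := mul_le_mul_of_nonneg_left h7 (by positivity : 0 ≤ 2 * r * η)
  have h9 := mul_le_mul_of_nonneg_left h2 hr.le
  -- Young's inequality for `10 η L ‖b - u‖`; the constant `6` is `5` from here plus `1` from the
  -- squared step.
  have h10 : 0 ≤ r * (5 * (η * L - ‖b - u‖) ^ 2) := by positivity
  have h11 : r * (r * η * ‖b - u‖ ^ 2) ≤ r * (r * α₁ * ‖b - u‖ ^ 2) := by gcongr
  linarith

end HeavyBallModel

namespace IsStochasticHeavyBall

variable {θinit zinit : E} {x : ℕ → Ω → X} {θ z : ℕ → Ω → E}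
  (M : HeavyBallModel f Θ G g Pr ρ r L L₁ α β)
  (hS : IsStochasticHeavyBall Θ G α β θinit zinit x θ z) (h0 : θinit ∈ Θ)
include hS h0

theorem mem (t : ℕ) (ω : Ω) : θ t ω ∈ Θ := by
  match t with
  | 0 => rw [hS.theta_zero]; exact h0
  | 1 => rw [hS.theta_one]; exact h0
  | t + 2 => exact (hS.theta_step (t + 1) (by omega) ω).1

include M

omit h0 in
theorem smul_z {t : ℕ} (ht : 2 ≤ t) (ω : Ω) : α t • z t ω =
    (α t * β) • G (θ t ω) (x t ω) + (1 - β) • (θ (t - 1) ω - θ t ω) := by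
  obtain ⟨s, rfl⟩ : ∃ s, t = s + 1 := ⟨t - 1, by omega⟩
  rw [hS.z_step s (by omega) ω, smul_add, smul_smul, smul_smul, Nat.add_sub_cancel,
    mul_div_cancel₀ _ (M.α_pos (s + 1) (by omega)).ne']

theorem increment_two (ω : Ω) : ‖θ 2 ω - θ 1 ω‖ ≤ α 1 * ‖zinit‖ := by
  have h := (hS.theta_step 1 le_rfl ω).norm_sub_le M.convex (mem hS h0 1 ω)
  rwa [sub_sub_cancel_left, norm_neg, norm_smul, Real.norm_of_nonneg (M.α_pos 1 le_rfl).le,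
    hS.z_one] at h

theorem increment_step {t : ℕ} (ht : 2 ≤ t) (ω : Ω) :
    ‖θ (t + 1) ω - θ t ω‖ ≤ β * (α t * L) + (1 - β) * ‖θ t ω - θ (t - 1) ω‖ := by
  have h := (hS.theta_step t (by omega) ω).norm_sub_le M.convex (mem hS h0 t ω)
  have hα := M.α_pos t (by omega)
  have hβ := M.β_pos
  rw [sub_sub_cancel_left, norm_neg, smul_z M hS ht] at h
  refine h.trans ((norm_add_le _ _).trans ?_)
  rw [norm_smul, norm_smul, Real.norm_of_nonneg (by positivity),
    Real.norm_of_nonneg (sub_nonneg.2 M.β_le), norm_sub_rev (θ (t - 1) ω)]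
  have h1 := mul_le_mul_of_nonneg_left (M.norm_G_le _ (mem hS h0 t ω) (x t ω))
    (mul_pos hα hβ).le
  linarith

theorem extrapolate_step_two {u : E} (hu : u ∈ Θ) (ω : Ω) :
    ‖extrapolate β θ 2 ω - u‖ ≤ ‖θinit - (α 1 / β) • zinit - u‖ := by
  have h := (hS.theta_step 1 le_rfl ω).extrapolate_norm_le M.convex M.β_pos M.β_le
    (mem hS h0 1 ω) hu
  rw [hS.z_one] at h
  rw [← hS.theta_one ω]
  exact h

/-- Since `θ_t - (α_t / β) z_t = θ̄_t - α_t G(θ_t, x_t)`, the momentum cancels and an ordinary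
subgradient step remains. The identity needs `t ≥ 2`, as `z_1` is arbitrary. -/
theorem extrapolate_step {u : E} (hu : u ∈ Θ) {t : ℕ} (ht : 2 ≤ t) (ω : Ω) :
    ‖extrapolate β θ (t + 1) ω - u‖ ≤
      ‖extrapolate β θ t ω - α t • G (θ t ω) (x t ω) - u‖ := by
  have h := (hS.theta_step t (by omega) ω).extrapolate_norm_le M.convex M.β_pos M.β_le
    (mem hS h0 t ω) hu
  have e : (α t / β) • z t ω =
      α t • G (θ t ω) (x t ω) + ((1 - β) / β) • (θ (t - 1) ω - θ t ω) := by
    rw [div_eq_inv_mul, mul_smul, smul_z M hS ht, smul_add, smul_smul, smul_smul]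
    congr 2
    · field_simp [M.β_pos.ne']
    · ring
  have e2 : θ t ω - (α t / β) • z t ω - u =
      extrapolate β θ t ω - α t • G (θ t ω) (x t ω) - u := by
    rw [e, extrapolate]; module
  rw [e2] at h
  exact h

omit hS h0 in
theorem norm_extrapolate_sub (t : ℕ) (ω : Ω) :
    ‖extrapolate β θ t ω - θ t ω‖ = (1 - β) / β * ‖θ t ω - θ (t - 1) ω‖ := by
  rw [extrapolate, add_sub_cancel_left, norm_smul,
    Real.norm_of_nonneg (div_nonneg (sub_nonneg.2 M.β_le) M.β_pos.le)]

omit M h0 in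
theorem extrapolate_one (ω : Ω) : extrapolate β θ 1 ω = θinit := by
  rw [extrapolate, Nat.sub_self, hS.theta_zero, hS.theta_one]
  simp

/-- The first step follows the arbitrary `z_1`, so `descent` does not apply. Testing with `Pr θinit`
and splitting the square costs a factor `2` on the initial gap. -/
theorem envelope_gap_two_le (ω : Ω) :
    moreauEnvelope f Θ (1 / r) (extrapolate β θ 2 ω) - ⨅ y, moreauEnvelope f Θ (1 / r) y ≤
      2 * (moreauEnvelope f Θ (1 / r) θinit - ⨅ y, moreauEnvelope f Θ (1 / r) y) +
        r * ((α 1 * ‖zinit‖) ^ 2 / β ^ 2) := by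
  have hr := M.r_pos
  have h1 := moreauEnvelope_le M.prox (extrapolate β θ 2 ω) (M.prox θinit).1
  have h2 := extrapolate_step_two M hS h0 (M.prox θinit).1 ω
  have h3 := residual_sq_le_gap hr M.bddBelow M.prox θinit
  have h4 := moreauEnvelope_eq (M.prox θinit)
  have e : θinit - (α 1 / β) • zinit - Pr θinit = (θinit - Pr θinit) - (α 1 / β) • zinit := by
    abel
  have h5 : ‖Pr θinit - extrapolate β θ 2 ω‖ ^ 2 ≤
      2 * ‖θinit - Pr θinit‖ ^ 2 + 2 * ((α 1 * ‖zinit‖) ^ 2 / β ^ 2) := by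
    rw [norm_sub_rev]
    rw [e] at h2
    have h6 := h2.trans (norm_sub_le _ _)
    rw [norm_smul, Real.norm_of_nonneg (div_pos (M.α_pos 1 le_rfl) M.β_pos).le] at h6
    have h7 := pow_le_pow_left₀ (norm_nonneg _) h6 2
    have h8 : (α 1 * ‖zinit‖) ^ 2 / β ^ 2 = (α 1 / β * ‖zinit‖) ^ 2 := by ring
    rw [h8]
    nlinarith [sq_nonneg (‖θinit - Pr θinit‖ - α 1 / β * ‖zinit‖)]
  rw [norm_sub_rev (Pr θinit) θinit] at h4
  nlinarith

omit hS in
-- From `r n ≤ 2 L` for the residual norm `n`, the left side is at most `2 L α_1 r n ≤ r (L ^ 2 α_1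
-- ^ 2 + n ^ 2)`, and `r n ^ 2` is at most twice the gap.
theorem first_term_le :
    α 1 * (r * ‖θinit - Pr θinit‖) ^ 2 ≤
      2 * (moreauEnvelope f Θ (1 / r) θinit - ⨅ y, moreauEnvelope f Θ (1 / r) y) +
        r * (L ^ 2 * α 1 ^ 2) := by
  have hr := M.r_pos
  have hrρ := sub_pos.2 M.rho_lt
  have hα := M.α_pos 1 le_rfl
  have hL := M.L_pos
  have h1 := residual_sq_le_gap hr M.bddBelow M.prox θinit
  have h2 := M.residual_le h0
  set n := ‖θinit - Pr θinit‖
  have hn : 0 ≤ n := norm_nonneg _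
  have h3 : r * n ≤ 2 * L := by
    have h4 : r * n ≤ r * (L / (r - ρ)) := by gcongr
    refine h4.trans ?_
    rw [mul_div_assoc', div_le_iff₀ hrρ]
    nlinarith [M.two_rho_le]
  have h5 : α 1 * (r * n) ^ 2 ≤ α 1 * (2 * L * (r * n)) := by
    rw [sq]; gcongr
  nlinarith [mul_nonneg hr.le (sq_nonneg (L * α 1 - n))]

theorem descent_sum_term {t s : ℕ} (ht : 2 ≤ t) (hst : s ≤ t) (ω : Ω) :
    α t * (r * ‖extrapolate β θ t ω - Pr (extrapolate β θ t ω)‖) ^ 2 ≤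
      2 * (moreauEnvelope f Θ (1 / r) (extrapolate β θ t ω) -
        moreauEnvelope f Θ (1 / r) (extrapolate β θ (t + 1) ω)) +
      r * (6 * L ^ 2 * α t ^ 2 +
        (5 + r * α 1) * (((1 - β) / β) ^ 2 * ‖θ t ω - θ (t - 1) ω‖ ^ 2) +
        4 * (L₁ + r) / (r - ρ) * (L * (α t * ∑ i ∈ Finset.Ico s t, ‖θ (i + 1) ω - θ i ω‖)) -
        2 * (α t * noiseTerm G g Pr (θ s ω) (x t ω))) := by
  have hr := M.r_pos
  have hα := (M.α_pos t (by omega)).le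
  have h1 := M.descent hα (M.α_anti 1 t le_rfl (by omega)) (mem hS h0 t ω) rfl
    (extrapolate_step M hS h0 (M.prox (extrapolate β θ t ω)).1 ht ω)
  rw [norm_extrapolate_sub M, mul_pow ((1 - β) / β)] at h1
  have h2 := M.noiseTerm_lip (mem hS h0 t ω) (mem hS h0 s ω) (x t ω)
  have h3 : ‖θ t ω - θ s ω‖ ≤ ∑ i ∈ Finset.Ico s t, ‖θ (i + 1) ω - θ i ω‖ := by
    rw [← Finset.sum_Ico_sub (fun i => θ i ω) hst]
    exact norm_sum_le _ _
  have h4 : 0 ≤ 2 * L * (L₁ + r) / (r - ρ) :=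
    div_nonneg (by have := M.L_pos; have := M.L₁_pos; positivity) (sub_pos.2 M.rho_lt).le
  have h5 := mul_le_mul_of_nonneg_left h3 h4
  have h6 := mul_le_mul_of_nonneg_left (h2.trans' (sub_le_sub_left h5 _))
    (by positivity : 0 ≤ 2 * r * α t)
  refine h1.trans (add_le_add_right ?_ _)
  have e : r * (4 * (L₁ + r) / (r - ρ) *
      (L * (α t * ∑ i ∈ Finset.Ico s t, ‖θ (i + 1) ω - θ i ω‖))) =
      2 * r * α t * (2 * L * (L₁ + r) / (r - ρ) *
        ∑ i ∈ Finset.Ico s t, ‖θ (i + 1) ω - θ i ω‖) := by ring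
  linarith

omit M hS h0 in
theorem rate_constant_le {β K R A : ℝ} (hβ0 : 0 < β) (hβ1 : β ≤ 1) (hK : 0 ≤ K) (hR : 0 ≤ R) :
    2 * (A ^ 2 / β ^ 2) + (5 + R) * (((1 - β) / β) ^ 2 * (A ^ 2 / β)) +
      K * (1 / 6 * (A ^ 2 / β ^ 2 + ((1 - β) / β) ^ 2 * (A ^ 2 / β))) ≤
      (5 + R + K) / β ^ 3 * A ^ 2 := by
  have e1 : A ^ 2 / β ^ 2 = β * (A ^ 2 / β ^ 3) := by field_simp
  have e2 : ((1 - β) / β) ^ 2 * (A ^ 2 / β) = (1 - β) ^ 2 * (A ^ 2 / β ^ 3) := by field_simp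
  have e3 : (5 + R + K) / β ^ 3 * A ^ 2 = (5 + R + K) * (A ^ 2 / β ^ 3) := by ring
  rw [e1, e2, e3]
  have hq : 0 ≤ A ^ 2 / β ^ 3 := by positivity
  have h1 : 2 * β + (5 + R) * (1 - β) ^ 2 + K * (1 / 6 * (β + (1 - β) ^ 2)) ≤ 5 + R + K := by
    have h2 : (1 - β) ^ 2 ≤ 1 - β := by nlinarith
    nlinarith [mul_le_mul_of_nonneg_left h2 hR, mul_le_mul_of_nonneg_left h2 hK,
      mul_nonneg hR hβ0.le]
  nlinarith [mul_le_mul_of_nonneg_right h1 hq]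

omit M hS h0 in
theorem rate_combination_le {Y Y₁ Y₂ P Q R c K D V W N Z : ℝ} (hY : Y = Y₁ + Y₂) (hY₁ : 0 ≤ Y₁)
    (hY₂ : 0 ≤ Y₂) (hc : 0 ≤ c) (hK : 0 ≤ K) (hR : 0 ≤ R) (hD : D ≤ Q + Y)
    (hV : V ≤ W + 1 / 6 * (P + c * (Q + Y)))
    (hZ : 2 * P + (5 + R) * (c * Q) + K * (1 / 6 * (P + c * Q)) ≤ Z) :
    Y₁ + 2 * P + (6 * Y₂ + (5 + R) * (c * D) + K * V - 2 * N) ≤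
      6 * Y + (5 + R + K) * c * Y + Z + K * W - 2 * N := by
  have f1 := mul_le_mul_of_nonneg_left hV hK
  have f2 := mul_le_mul_of_nonneg_left (mul_le_mul_of_nonneg_left hD hc)
    (by positivity : 0 ≤ 5 + R)
  have f3 : 0 ≤ K * (c * Y) := by rw [hY]; positivity
  linarith

/-- The pathwise version of the rate, with the stochastic error still present. -/
theorem pathwise_rate {k : ℕ → ℕ} (hk : ∀ t, 1 ≤ t → 1 ≤ k t ∧ k t ≤ t) {T : ℕ} (hT : 1 ≤ T)
    (ω : Ω) :
    ∑ t ∈ Finset.Icc 1 T, α t * (r * ‖extrapolate β θ t ω - Pr (extrapolate β θ t ω)‖) ^ 2 ≤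
      6 * (moreauEnvelope f Θ (1 / r) θinit - ⨅ y, moreauEnvelope f Θ (1 / r) y) +
      r * ((6 + shbConst ρ r L₁ (α 1) * (1 - β) ^ 2 / β ^ 2) * L ^ 2
            * ∑ t ∈ Finset.Icc 1 T, α t ^ 2
          + shbConst ρ r L₁ (α 1) / β ^ 3 * (α 1 ^ 2 * ‖zinit‖ ^ 2)
          + 16 * L ^ 2 * (L₁ + r) / (r - ρ)
            * ∑ t ∈ Finset.Icc 1 T, (k t : ℝ) * α t * α (max 1 (t - k t))
          - 2 * ∑ t ∈ Finset.Icc 2 T,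
              α t * noiseTerm G g Pr (θ (t - k (t - 1)) ω) (x t ω)) := by
  have hr := M.r_pos
  have hL := M.L_pos
  have hL₁ := M.L₁_pos
  have hα1 := M.α_pos 1 le_rfl
  set A := α 1 * ‖zinit‖ with hA
  set δ : ℕ → ℝ := fun t => ‖θ t ω - θ (t - 1) ω‖ with hδdef
  set env := moreauEnvelope f Θ (1 / r)
  set B : ℕ → E := fun t => extrapolate β θ t ω with hB
  set K := 4 * (L₁ + r) / (r - ρ) with hKdef
  have hK : 0 ≤ K := div_nonneg (by positivity) (sub_pos.2 M.rho_lt).le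
  have hδ : ∀ t, 0 ≤ δ t := fun t => norm_nonneg _
  have hδ2 : δ 2 ≤ A := increment_two M hS h0 ω
  have hδs : ∀ t, 2 ≤ t → δ (t + 1) ≤ β * (α t * L) + (1 - β) * δ t := fun t ht =>
    increment_step M hS h0 ht ω
  have hterm : ∀ t ∈ Finset.Icc 2 T, _ := fun t ht =>
    descent_sum_term M hS h0 (Finset.mem_Icc.1 ht).1 (Nat.sub_le t (k (t - 1))) ω
  have hsum := Finset.sum_le_sum hterm
  simp only [Finset.sum_add_distrib, Finset.sum_sub_distrib, ← Finset.mul_sum] at hsum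
  have hIco : Finset.Icc 2 T = Finset.Ico 2 (T + 1) := by ext; simp
  have htel : ∑ t ∈ Finset.Icc 2 T, env (B t) - ∑ t ∈ Finset.Icc 2 T, env (B (t + 1)) =
      env (B 2) - env (B (T + 1)) := by
    have h := Finset.sum_Ico_sub (fun t => env (B t)) (by omega : 2 ≤ T + 1)
    rw [Finset.sum_sub_distrib, ← hIco] at h
    linarith
  have hinf : ⨅ y, env y ≤ env (B (T + 1)) :=
    ciInf_le (bddBelow_moreauEnvelope hr M.bddBelow M.prox) _
  -- The coefficient `6` of the initial gap is `2 * 2` from the telescoped envelope starting at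
  -- `θ̄_2`, plus `2` from the term `t = 1`.
  have hgap2 := envelope_gap_two_le M hS h0 ω
  have hfirst := first_term_le M h0
  have hsq := sum_sq_increment_le M.β_pos M.β_le hδ hδ2 hδs (by omega : 2 ≤ T + 1)
  rw [← hIco] at hsq
  have hwin := sum_mul_window_le M.β_pos M.β_le hL.le hδ (by positivity) M.α_pos M.α_anti hδ2
    hδs hk hT
  have hrate := rate_constant_le (A := A) M.β_pos M.β_le hK (by positivity : 0 ≤ r * α 1)
  have hsplit : ∀ F : ℕ → ℝ, ∑ t ∈ Finset.Icc 1 T, F t = F 1 + ∑ t ∈ Finset.Icc 2 T, F t := by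
    intro F
    have : Finset.Icc 1 T = Finset.Ico 1 (T + 1) := by ext; simp
    rw [this, hIco, Finset.sum_eq_sum_Ico_succ_bot (by omega)]
  have hB1 : extrapolate β θ 1 ω = θinit := extrapolate_one hS ω
  rw [hsplit, hB1]
  set S := ∑ t ∈ Finset.Icc 1 T, α t ^ 2 with hSdef
  have hS2 : S = α 1 ^ 2 + ∑ t ∈ Finset.Icc 2 T, α t ^ 2 := hsplit _
  set S2 := ∑ t ∈ Finset.Icc 2 T, α t ^ 2
  have hS20 : 0 ≤ S2 := Finset.sum_nonneg fun _ _ => sq_nonneg _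
  set W := ∑ t ∈ Finset.Icc 1 T, (k t : ℝ) * α t * α (max 1 (t - k t))
  set N := ∑ t ∈ Finset.Icc 2 T, α t * noiseTerm G g Pr (θ (t - k (t - 1)) ω) (x t ω)
  set V := ∑ t ∈ Finset.Icc 2 T, α t * ∑ i ∈ Finset.Ico (t - k (t - 1)) t, ‖θ (i + 1) ω - θ i ω‖
  set D := ∑ t ∈ Finset.Icc 2 T, ‖θ t ω - θ (t - 1) ω‖ ^ 2
  set c := ((1 - β) / β) ^ 2 with hc
  have hc0 : 0 ≤ c := sq_nonneg _
  have hV : L * V ≤ 4 * L ^ 2 * W + 1 / 6 * (A ^ 2 / β ^ 2 + c * (A ^ 2 / β + L ^ 2 * S)) := hwin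
  have hD : D ≤ A ^ 2 / β + L ^ 2 * S := by
    have : D ≤ A ^ 2 / β + L ^ 2 * S2 := hsq
    nlinarith [sq_nonneg (L * α 1)]
  have e1 : shbConst ρ r L₁ (α 1) = 5 + r * α 1 + K := rfl
  have e2 : shbConst ρ r L₁ (α 1) * (1 - β) ^ 2 / β ^ 2 = (5 + r * α 1 + K) * c := by
    rw [e1, hc, div_pow]; ring
  have e3 : 16 * L ^ 2 * (L₁ + r) / (r - ρ) * W = K * (4 * L ^ 2 * W) := by rw [hKdef]; ring
  have e4 : α 1 ^ 2 * ‖zinit‖ ^ 2 = A ^ 2 := by rw [hA]; ring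
  rw [e2, e3, e4, e1]
  have hfin : L ^ 2 * α 1 ^ 2 + 2 * (A ^ 2 / β ^ 2) +
      (6 * L ^ 2 * S2 + (5 + r * α 1) * (c * D) + K * (L * V) - 2 * N) ≤
      (6 + (5 + r * α 1 + K) * c) * L ^ 2 * S + (5 + r * α 1 + K) / β ^ 3 * A ^ 2 +
        K * (4 * L ^ 2 * W) - 2 * N := by
    have := rate_combination_le (N := N) (Y := L ^ 2 * S) (Y₁ := L ^ 2 * α 1 ^ 2)
      (Y₂ := L ^ 2 * S2) (by rw [hS2]; ring) (by positivity) (by positivity) hc0 hK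
      (by positivity) hD hV hrate
    linarith only [this]
  have hfin' := mul_le_mul_of_nonneg_left hfin hr.le
  have htel' : ∑ t ∈ Finset.Icc 2 T, env (extrapolate β θ t ω) -
      ∑ t ∈ Finset.Icc 2 T, env (extrapolate β θ (t + 1) ω) =
      env (extrapolate β θ 2 ω) - env (extrapolate β θ (T + 1) ω) := htel
  have hinf' : ⨅ y, env y ≤ env (extrapolate β θ (T + 1) ω) := hinf
  linarith only [hfin', hsum, htel', hinf', hgap2, hfirst]

end IsStochasticHeavyBall

end Pathwise

/-! ### Total variation and integrals of bounded functions. -/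

section TotalVariation

variable {X : Type*} [MeasurableSpace X] {μ ν : Measure X} [IsProbabilityMeasure μ]
  [IsProbabilityMeasure ν]

theorem abs_measureReal_sub_le_one (A : Set X) : |μ.real A - ν.real A| ≤ 1 := by
  have h1 := measureReal_le_one (μ := μ) (s := A)
  have h2 := measureReal_le_one (μ := ν) (s := A)
  have h3 := measureReal_nonneg (μ := μ) (s := A)
  have h4 := measureReal_nonneg (μ := ν) (s := A)
  rw [abs_le]
  constructor <;> linarith

theorem abs_measureReal_sub_le_tvDist {A : Set X} (hA : MeasurableSet A) :
    |μ.real A - ν.real A| ≤ tvDist μ ν :=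
  le_ciSup (f := fun A : {A : Set X // MeasurableSet A} => |μ.real A.1 - ν.real A.1|)
    ⟨1, by rintro _ ⟨A, rfl⟩; exact abs_measureReal_sub_le_one _⟩ ⟨A, hA⟩

theorem tvDist_nonneg : 0 ≤ tvDist μ ν :=
  (abs_nonneg _).trans (abs_measureReal_sub_le_tvDist MeasurableSet.empty)

theorem tvDist_le_one : tvDist μ ν ≤ 1 :=
  have : Nonempty {A : Set X // MeasurableSet A} := ⟨⟨∅, MeasurableSet.empty⟩⟩
  ciSup_le fun _ => abs_measureReal_sub_le_one _

/-- Bounded functions are integrated almost equally by measures close in total variation. -/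
theorem abs_integral_sub_le_tvDist {ψ : X → ℝ} (hψ : Measurable ψ) {B : ℝ} (hB : ∀ y, |ψ y| ≤ B) :
    |∫ y, ψ y ∂μ - ∫ y, ψ y ∂ν| ≤ 2 * B * tvDist μ ν := by
  have hX : Nonempty X := μ.nonempty_of_neZero
  have hB0 : 0 ≤ B := (abs_nonneg _).trans (hB hX.some)
  have hint : ∀ (κ : Measure X) [IsProbabilityMeasure κ], Integrable ψ κ := fun κ _ =>
    Integrable.of_bound hψ.aestronglyMeasurable B (Eventually.of_forall hB)
  -- Layer-cake formula for `ψ + B`, which takes values in `[0, 2 B]`. The tail probabilities differ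
  -- by at most `tvDist`, over an interval of length `2 B`.
  have hlayer : ∀ (κ : Measure X) [IsProbabilityMeasure κ],
      ∫ y, ψ y ∂κ + B = ∫ t in Set.Ioc 0 (2 * B), κ.real {y | t ≤ ψ y + B} := by
    intro κ _
    have h := ((hint κ).add (integrable_const B)).integral_eq_integral_Ioc_meas_le (M := 2 * B)
      (Eventually.of_forall fun y => by
        have := (abs_le.1 (hB y)).1
        simp only [Pi.zero_apply, Pi.add_apply]; linarith)
      (Eventually.of_forall fun y => by
        have := (abs_le.1 (hB y)).2
        simp only [Pi.add_apply]; linarith)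
    simp only [Pi.add_apply] at h
    rw [← h, integral_add (hint κ) (integrable_const B)]
    simp
  have hmeas : ∀ (κ : Measure X) [IsProbabilityMeasure κ],
      IntegrableOn (fun t => κ.real {y | t ≤ ψ y + B}) (Set.Ioc 0 (2 * B)) := by
    intro κ _
    have hanti : Antitone fun t => κ.real {y | t ≤ ψ y + B} := fun s t hst =>
      measureReal_mono fun y hy => le_trans hst hy
    exact Integrable.of_bound hanti.measurable.aestronglyMeasurable 1
      (Eventually.of_forall fun t => by
        rw [Real.norm_of_nonneg measureReal_nonneg]; exact measureReal_le_one)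
  have e : ∫ y, ψ y ∂μ - ∫ y, ψ y ∂ν =
      ∫ t in Set.Ioc 0 (2 * B), (μ.real {y | t ≤ ψ y + B} - ν.real {y | t ≤ ψ y + B}) := by
    rw [integral_sub (hmeas μ) (hmeas ν), ← hlayer μ, ← hlayer ν]; ring
  rw [e, ← Real.norm_eq_abs]
  refine (norm_setIntegral_le_of_norm_le_const (C := tvDist μ ν) measure_Ioc_lt_top fun t _ => ?_).trans ?_
  · exact abs_measureReal_sub_le_tvDist (measurableSet_le measurable_const (hψ.add_const B))
  · rw [Real.volume_real_Ioc_of_le (by positivity)]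
    linarith

end TotalVariation

/-! ### Conditional laws and the mixing coefficient. -/

section Mixing

variable {Ω X : Type*} [MeasurableSpace Ω] [MeasurableSpace X] [StandardBorelSpace X] [Nonempty X]
  {P : Measure Ω} [IsProbabilityMeasure P] {π : Measure X} [IsProbabilityMeasure π]
  {x : ℕ → Ω → X}

omit [StandardBorelSpace X] [Nonempty X] in
theorem measurable_history (hx : ∀ n, Measurable (x n)) (m : ℕ) : Measurable (history x m) :=
  measurable_pi_lambda _ fun _ => hx _

theorem ae_tvDist_le_mixingCoeff (m n : ℕ) : ∀ᵐ h ∂(P.map (history x m)),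
    tvDist (condDistrib (x n) (history x m) P h) π ≤ mixingCoeff P π x m n :=
  ae_le_essSup ⟨1, by simpa using Eventually.of_forall fun _ => tvDist_le_one⟩

theorem mixingCoeff_nonneg (hx : ∀ n, Measurable (x n)) (m n : ℕ) :
    0 ≤ mixingCoeff P π x m n := by
  have : IsProbabilityMeasure (P.map (history x m)) :=
    Measure.isProbabilityMeasure_map (measurable_history hx m).aemeasurable
  obtain ⟨h, hh⟩ := (ae_tvDist_le_mixingCoeff (P := P) (π := π) (x := x) m n).exists
  exact tvDist_nonneg.trans hh

/-- A bounded function with vanishing `π`-averages of its sections has a small expectation at a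
history and a later sample. -/
theorem abs_integral_history_le (hx : ∀ n, Measurable (x n)) {m : ℕ}
    {F : (Fin m → X) → X → ℝ} (hF : Measurable (Function.uncurry F)) {B : ℝ}
    {ψ : (Fin m → X) → X → ℝ} (hψ : ∀ h, Measurable (ψ h)) (hψB : ∀ h y, |ψ h y| ≤ B)
    (hFψ : ∀ h y, F h y = ψ h y - ∫ y', ψ h y' ∂π) (n : ℕ) :
    |∫ ω, F (history x m ω) (x n ω) ∂P| ≤ 2 * B * mixingCoeff P π x m n := by
  have hH := measurable_history hx m
  have : IsProbabilityMeasure (P.map (history x m)) :=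
    Measure.isProbabilityMeasure_map hH.aemeasurable
  have hB0 : 0 ≤ B := (abs_nonneg _).trans
    (hψB (fun _ => Classical.arbitrary X) (Classical.arbitrary X))
  have hψint : ∀ h (κ : Measure X) [IsProbabilityMeasure κ], Integrable (ψ h) κ := fun h κ _ =>
    Integrable.of_bound (hψ h).aestronglyMeasurable B (Eventually.of_forall (hψB h))
  have hFB : ∀ h y, ‖F h y‖ ≤ B + B := by
    intro h y
    rw [hFψ]
    refine (norm_sub_le _ _).trans (add_le_add (hψB h y) ?_)
    simpa using norm_integral_le_of_norm_le_const (μ := π) (f := ψ h) (C := B)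
      (Eventually.of_forall (hψB h))
  -- The joint law is disintegrated over the history. For a fixed history the inner integral of `F`
  -- is the difference of the integrals of `ψ h` under the conditional law and under `π`.
  have hcomp := compProd_map_condDistrib (mβ := MeasurableSpace.pi) (μ := P) (X := history x m) (hx n).aemeasurable
  have e1 : ∫ ω, F (history x m ω) (x n ω) ∂P =
      ∫ p, Function.uncurry F p ∂(P.map fun ω => (history x m ω, x n ω)) := by
    rw [integral_map (hH.prodMk (hx n)).aemeasurable hF.aestronglyMeasurable]
    rfl
  rw [e1, ← hcomp, Measure.integral_compProd
    (Integrable.of_bound hF.aestronglyMeasurable (B + B) (Eventually.of_forall fun p => hFB _ _)),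
    ← Real.norm_eq_abs]
  have hbound := norm_integral_le_of_norm_le_const (μ := P.map (history x m))
    (C := 2 * B * mixingCoeff P π x m n)
    (f := fun h => ∫ y, Function.uncurry F (h, y) ∂(condDistrib (x n) (history x m) P h)) (by
      filter_upwards [ae_tvDist_le_mixingCoeff (P := P) (π := π) (x := x) m n] with h hh
      simp only [Function.uncurry_apply_pair, hFψ]
      rw [integral_sub (hψint h _) (integrable_const _), integral_const, probReal_univ, one_smul]
      refine (abs_integral_sub_le_tvDist (hψ h) (hψB h)).trans ?_
      gcongr)
  simpa using hbound

end Mixing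

/-! ### Measurability of compositions on a closed convex set. -/

section Caratheodory

variable {E : Type*} [NormedAddCommGroup E] [InnerProductSpace ℝ E] {Θ : Set E}

theorem exists_projection [CompleteSpace E] (hΘ : Convex ℝ Θ) (hcl : IsClosed Θ)
    (hne : Θ.Nonempty) : ∃ pj : E → E, ∀ y, IsProjOnto Θ y (pj y) := by
  choose pj hpj hmin using exists_norm_eq_iInf_of_complete_convex hne hcl.isComplete hΘ
  refine ⟨pj, fun y => ⟨hpj y, fun u hu => ?_⟩⟩
  rw [hmin y]
  exact ciInf_le (f := fun w : Θ => ‖y - w‖)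
    ⟨0, by rintro _ ⟨w, rfl⟩; exact norm_nonneg _⟩ ⟨u, hu⟩

theorem IsProjOnto.dist_le (hΘ : Convex ℝ Θ) {y q y' q' : E} (hq : IsProjOnto Θ y q)
    (hq' : IsProjOnto Θ y' q') : ‖q - q'‖ ≤ ‖y - y'‖ := by
  have h1 := hq.inner_le_zero hΘ hq'.1
  have h2 := hq'.inner_le_zero hΘ hq.1
  have h3 : ‖q - q'‖ ^ 2 ≤ inner ℝ (y - y') (q - q') := by
    have e : inner ℝ (y - y') (q - q') =
        ‖q - q'‖ ^ 2 - inner ℝ (y - q) (q' - q) - inner ℝ (y' - q') (q - q') := by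
      rw [← real_inner_self_eq_norm_sq]
      simp only [inner_sub_left, inner_sub_right]; ring
    linarith
  have h4 := h3.trans (real_inner_le_norm _ _)
  rcases (norm_nonneg (q - q')).eq_or_lt with h0 | h0
  · rw [← h0]; exact norm_nonneg _
  · refine le_of_mul_le_mul_right ?_ h0
    linarith

omit [InnerProductSpace ℝ E] in
theorem IsProjOnto.eq_of_mem {y q : E} (hq : IsProjOnto Θ y q) (hy : y ∈ Θ) :
    q = y := by
  have h := hq.2 y hy
  rw [sub_self, norm_zero] at h
  exact (sub_eq_zero.1 (norm_le_zero_iff.1 h)).symm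

theorem IsProjOnto.eq (hΘ : Convex ℝ Θ) {y q q' : E} (hq : IsProjOnto Θ y q)
    (hq' : IsProjOnto Θ y q') : q = q' := by
  have h := hq.dist_le hΘ hq'
  rw [sub_self, norm_zero] at h
  exact sub_eq_zero.1 (norm_le_zero_iff.1 h)

theorem continuous_projection (hΘ : Convex ℝ Θ) {pj : E → E} (hpj : ∀ y, IsProjOnto Θ y (pj y)) :
    Continuous pj :=
  LipschitzWith.continuous (K := 1) <| LipschitzWith.of_dist_le_mul fun y y' => by
    simpa [dist_eq_norm] using (hpj y).dist_le hΘ (hpj y')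

omit [InnerProductSpace ℝ E] in
theorem continuousOn_of_norm_sub_le {E' : Type*} [NormedAddCommGroup E'] {F : E → E'} {C : ℝ}
    (hC : 0 ≤ C) (h : ∀ u ∈ Θ, ∀ v ∈ Θ, ‖F u - F v‖ ≤ C * ‖u - v‖) : ContinuousOn F Θ :=
  LipschitzOnWith.continuousOn (K := C.toNNReal) <|
    LipschitzOnWith.of_dist_le_mul fun u hu v hv => by
      rw [dist_eq_norm, dist_eq_norm, Real.coe_toNNReal C hC]
      exact h u hu v hv

/-- A Caratheodory function on a closed convex set, evaluated along measurable maps. -/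
theorem measurable_caratheodory [MeasurableSpace E] [BorelSpace E] [SecondCountableTopology E]
    {X A : Type*} [MeasurableSpace X] [MeasurableSpace A]
    (hΘ : Convex ℝ Θ) {pj : E → E} (hpj : ∀ y, IsProjOnto Θ y (pj y)) {F : E → X → E}
    (hcont : ∀ y, ContinuousOn (fun u => F u y) Θ) (hmeas : ∀ u ∈ Θ, Measurable (F u))
    {a : A → E} {b : A → X} (ha : Measurable a) (haΘ : ∀ i, a i ∈ Θ) (hb : Measurable b) :
    Measurable fun i => F (a i) (b i) := by
  -- Composition with the projection extends `F` continuously from `Θ` to the whole space without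
  -- changing it on `Θ`.
  have h := measurable_uncurry_of_continuous_of_measurable (u := fun u y => F (pj u) y)
    (fun y => (hcont y).comp_continuous (continuous_projection hΘ hpj) fun u => (hpj u).1)
    (fun u => hmeas _ (hpj u).1)
  have h2 := h.comp (ha.prodMk hb)
  convert h2 using 2 with i
  simp only [Function.comp, Function.uncurry_apply_pair]
  rw [(hpj (a i)).eq_of_mem (haΘ i)]

end Caratheodory

/-! ### Adaptedness of the iterates and the expected noise. -/

namespace IsStochasticHeavyBall

variable {E Ω X : Type*} [NormedAddCommGroup E] [InnerProductSpace ℝ E] [CompleteSpace E]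
  [MeasurableSpace E] [BorelSpace E] [SecondCountableTopology E] [MeasurableSpace X]
  {f : E → ℝ} {Θ : Set E} {G : E → X → E} {g Pr : E → E} {ρ r L L₁ : ℝ} {α : ℕ → ℝ} {β : ℝ}
  {θinit zinit : E} {x : ℕ → Ω → X} {θ z : ℕ → Ω → E}

omit [CompleteSpace E] [MeasurableSpace E] [BorelSpace E] [SecondCountableTopology E]
  [MeasurableSpace X] in
theorem continuousOn_G (M : HeavyBallModel f Θ G g Pr ρ r L L₁ α β) (y : X) :
    ContinuousOn (fun u => G u y) Θ :=
  continuousOn_of_norm_sub_le M.L₁_pos.le (M.G_lip y)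

/-- The iterates are measurable functions of the history. -/
theorem exists_eq_history (M : HeavyBallModel f Θ G g Pr ρ r L L₁ α β)
    (hS : IsStochasticHeavyBall Θ G α β θinit zinit x θ z) (h0 : θinit ∈ Θ) (hcl : IsClosed Θ)
    (hG : ∀ u ∈ Θ, Measurable (G u)) (m : ℕ) :
    ∃ Φ Φ' : (Fin m → X) → E, Measurable Φ ∧ Measurable Φ' ∧ (∀ h, Φ h ∈ Θ) ∧
      (∀ ω, θ (m + 1) ω = Φ (history x m ω)) ∧ ∀ ω, θ m ω = Φ' (history x m ω) := by
  obtain ⟨pj, hpj⟩ := exists_projection M.convex hcl ⟨θinit, h0⟩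
  have hpjc := (continuous_projection M.convex hpj).measurable
  induction m with
  | zero =>
    exact ⟨fun _ => θinit, fun _ => θinit, measurable_const, measurable_const, fun _ => h0,
      hS.theta_one, hS.theta_zero⟩
  | succ m ih =>
    obtain ⟨Φ, Φ', hΦ, hΦ', hΦΘ, hθ, hθ'⟩ := ih
    have hres : Measurable fun h : Fin (m + 1) → X => fun i : Fin m => h i.castSucc :=
      measurable_pi_lambda _ fun i => measurable_pi_apply _
    have hstep : ∀ ω, θ (m + 2) ω = pj (θ (m + 1) ω - α (m + 1) • z (m + 1) ω) := fun ω =>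
      (hS.theta_step (m + 1) (by omega) ω).eq M.convex (hpj _)
    -- The iterate `θ_2` is deterministic because `z_1` is; only from `θ_3` on does the update use a
    -- sample and two previous iterates.
    rcases Nat.eq_zero_or_pos m with rfl | hm
    · refine ⟨fun _ => pj (θinit - α 1 • zinit), fun h => Φ fun i => h i.castSucc,
        measurable_const, hΦ.comp hres, fun _ => (hpj _).1, fun ω => ?_, hθ⟩
      rw [hstep, zero_add, hS.theta_one, hS.z_one]
    · refine ⟨fun h => pj (Φ (fun i => h i.castSucc) - ((α (m + 1) * β) •
        G (Φ fun i => h i.castSucc) (h (Fin.last m)) +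
        (1 - β) • (Φ' (fun i => h i.castSucc) - Φ fun i => h i.castSucc))),
        fun h => Φ fun i => h i.castSucc, ?_, hΦ.comp hres, fun _ => (hpj _).1, fun ω => ?_, hθ⟩
      · have h1 : Measurable fun h : Fin (m + 1) → X =>
            G (Φ fun i => h i.castSucc) (h (Fin.last m)) :=
          measurable_caratheodory M.convex hpj (continuousOn_G M) hG (hΦ.comp hres)
            (fun _ => hΦΘ _) (measurable_pi_apply _)
        have h2 := hΦ.comp hres
        have h3 := hΦ'.comp hres
        exact hpjc.comp (h2.sub ((h1.const_smul _).add ((h3.sub h2).const_smul _)))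
      · rw [hstep, smul_z M hS (by omega), Nat.add_sub_cancel, hθ, hθ']
        rfl

/-- The stochastic error at a past iterate has a small expectation. -/
theorem abs_integral_noiseTerm_le [MeasurableSpace Ω] [StandardBorelSpace X] [Nonempty X]
    {P : Measure Ω} [IsProbabilityMeasure P] {π : Measure X} [IsProbabilityMeasure π]
    (M : HeavyBallModel f Θ G g Pr ρ r L L₁ α β)
    (hS : IsStochasticHeavyBall Θ G α β θinit zinit x θ z) (h0 : θinit ∈ Θ) (hcl : IsClosed Θ)
    (hG : ∀ u ∈ Θ, Measurable (G u)) (hx : ∀ n, Measurable (x n))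
    (hg : ∀ u ∈ Θ, g u = ∫ y, G u y ∂π) (m n : ℕ) :
    Integrable (fun ω => noiseTerm G g Pr (θ (m + 1) ω) (x n ω)) P ∧
    |∫ ω, noiseTerm G g Pr (θ (m + 1) ω) (x n ω) ∂P| ≤
      2 * (L * (L / (r - ρ))) * mixingCoeff P π x m n := by
  obtain ⟨Φ, Φ', hΦ, hΦ', hΦΘ, hθ, hθ'⟩ := exists_eq_history M hS h0 hcl hG m
  obtain ⟨pj, hpj⟩ := exists_projection M.convex hcl ⟨θinit, h0⟩
  have hL := M.L_pos
  have hrρ := sub_pos.2 M.rho_lt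
  have hGΦ : Measurable fun p : (Fin m → X) × X => G (Φ p.1) p.2 :=
    measurable_caratheodory M.convex hpj (continuousOn_G M) hG (hΦ.comp measurable_fst)
      (fun _ => hΦΘ _) measurable_snd
  have hgΦ : Measurable fun h : Fin m → X => g (Φ h) := by
    have hc : ContinuousOn g Θ := continuousOn_of_norm_sub_le M.L₁_pos.le M.g_lip
    exact measurable_caratheodory (X := Unit) (F := fun u _ => g u) (b := fun _ => ()) M.convex hpj
      (fun _ => hc) (fun _ _ => measurable_const) hΦ hΦΘ measurable_const
  have hres : Measurable fun u : E => u - Pr u :=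
    (LipschitzWith.continuous (K := 1) <| LipschitzWith.of_dist_le_mul fun u v => by
      simpa [dist_eq_norm] using M.residual_lip u v).measurable
  have hF : Measurable (Function.uncurry fun (h : Fin m → X) y => noiseTerm G g Pr (Φ h) y) :=
    (hGΦ.sub (hgΦ.comp measurable_fst)).inner ((hres.comp hΦ).comp measurable_fst)
  have hGint : ∀ h, Integrable (G (Φ h)) π := fun h =>
    Integrable.of_bound (hG _ (hΦΘ h)).aestronglyMeasurable L
      (Eventually.of_forall fun y => M.norm_G_le _ (hΦΘ h) y)
  have hbd : ∀ h y, |inner ℝ (G (Φ h) y) (Φ h - Pr (Φ h))| ≤ L * (L / (r - ρ)) := fun h y =>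
    (abs_real_inner_le_norm _ _).trans
      (mul_le_mul (M.norm_G_le _ (hΦΘ h) y) (M.residual_le (hΦΘ h)) (norm_nonneg _) hL.le)
  constructor
  · simp only [hθ]
    refine Integrable.of_bound (hF.comp ((measurable_history hx m).prodMk
      (hx n))).aestronglyMeasurable (2 * L * (L / (r - ρ))) (Eventually.of_forall fun ω => ?_)
    exact (abs_real_inner_le_norm _ _).trans (mul_le_mul (M.norm_sub_g_le (hΦΘ _) _)
      (M.residual_le (hΦΘ _)) (norm_nonneg _) (by positivity))
  · simp only [hθ]
    refine abs_integral_history_le (F := fun h y => noiseTerm G g Pr (Φ h) y) hx hF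
      (ψ := fun h y => inner ℝ (G (Φ h) y) (Φ h - Pr (Φ h)))
      (fun h => (hG _ (hΦΘ h)).inner measurable_const) hbd (fun h y => ?_) n
    -- As `g` is the `π`-average of `G`, the noise is `ψ` minus its `π`-average. Bounding `ψ` by `L
    -- * (L / (r - ρ))` rather than the noise itself avoids an extra factor `2`.
    have e : ∫ y', inner ℝ (G (Φ h) y') (Φ h - Pr (Φ h)) ∂π =
        inner ℝ (g (Φ h)) (Φ h - Pr (Φ h)) := by
      rw [hg _ (hΦΘ h), real_inner_comm, ← integral_inner (hGint h)]
      exact integral_congr_ae (Eventually.of_forall fun y' => real_inner_comm _ _)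
    rw [e, noiseTerm, inner_sub_left]

end IsStochasticHeavyBall

/-! ### Output at a random or a best index. -/

section RandomIndex

variable {Ω X : Type*} [MeasurableSpace Ω] [MeasurableSpace X] {P : Measure Ω}
  [IsProbabilityMeasure P] {α : ℕ → ℝ} {x : ℕ → Ω → X} {T : ℕ} {τ : Ω → ℕ} {b : ℕ → Ω → ℝ}

theorem IsRandomIndex.ae_mem (hτ : IsRandomIndex P α x T τ)
    (hpos : 0 < ∑ t ∈ Finset.Icc 1 T, α t) : ∀ᵐ ω ∂P, τ ω ∈ Finset.Icc 1 T := by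
  have h1 : P.real (τ ⁻¹' (Finset.Icc 1 T : Finset ℕ)) = 1 := by
    have e : τ ⁻¹' ((Finset.Icc 1 T : Finset ℕ) : Set ℕ) =
        ⋃ j ∈ Finset.Icc 1 T, {ω | τ ω = j} := by
      ext ω; simp
    rw [e, measureReal_biUnion_finset]
    · rw [Finset.sum_congr rfl hτ.law, ← Finset.sum_div, div_self hpos.ne']
    · intro i _ j _ hij
      exact Set.disjoint_left.2 fun ω (h : τ ω = i) (h' : τ ω = j) => hij (h.symm.trans h')
    · exact fun j _ => hτ.measurable (measurableSet_singleton j)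
  have hm : MeasurableSet (τ ⁻¹' ((Finset.Icc 1 T : Finset ℕ) : Set ℕ)) :=
    hτ.measurable (Set.to_countable _).measurableSet
  exact (mem_ae_iff_prob_eq_one hm).2 (by
    rw [Measure.real, ENNReal.toReal_eq_one_iff] at h1
    exact h1)

/-- Each `b t` is a function of the data, hence independent of the event `τ = t`; the expectation
factors term by term, and the bound is in fact an equality. -/
theorem IsRandomIndex.integral_le (hx : ∀ n, Measurable (x n)) (hτ : IsRandomIndex P α x T τ)
    (hpos : 0 < ∑ t ∈ Finset.Icc 1 T, α t)
    (hb : ∀ t, 1 ≤ t → Integrable (b t) P)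
    (hfac : ∀ t, 1 ≤ t → ∃ φ : (ℕ → X) → ℝ, Measurable φ ∧ ∀ ω, b t ω = φ fun n => x (n + 1) ω) :
    Integrable (fun ω => b (τ ω) ω) P ∧ ∫ ω, b (τ ω) ω ∂P ≤
      1 / (∑ t ∈ Finset.Icc 1 T, α t) * ∫ ω, ∑ t ∈ Finset.Icc 1 T, α t * b t ω ∂P := by
  have hset : ∀ t, MeasurableSet {ω | τ ω = t} := fun t =>
    hτ.measurable (measurableSet_singleton t)
  have hae : (fun ω => b (τ ω) ω) =ᵐ[P]
      fun ω => ∑ t ∈ Finset.Icc 1 T, {ω | τ ω = t}.indicator (b t) ω := by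
    filter_upwards [hτ.ae_mem hpos] with ω hω
    rw [Finset.sum_eq_single_of_mem (f := fun t => {ω | τ ω = t}.indicator (b t) ω) _ hω
      fun t _ ht => Set.indicator_of_notMem (s := {ω | τ ω = t})
        (fun h : τ ω = t => ht h.symm) _]
    exact (Set.indicator_of_mem (s := {ω' | τ ω' = τ ω}) (show τ ω = τ ω from rfl) _).symm
  have hint : ∀ t ∈ Finset.Icc 1 T, Integrable ({ω | τ ω = t}.indicator (b t)) P := fun t ht =>
    (hb t (Finset.mem_Icc.1 ht).1).indicator (hset t)
  refine ⟨(integrable_finsetSum _ hint).congr hae.symm, le_of_eq ?_⟩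
  rw [integral_congr_ae hae, integral_finsetSum _ hint,
    integral_finsetSum _ fun t ht => (hb t (Finset.mem_Icc.1 ht).1).const_mul _, Finset.mul_sum]
  refine Finset.sum_congr rfl fun t ht => ?_
  obtain ⟨φ, hφ, hbφ⟩ := hfac t (Finset.mem_Icc.1 ht).1
  have hseq : Measurable fun ω (n : ℕ) => x (n + 1) ω := measurable_pi_lambda _ fun n => hx _
  have h := hτ.indep.integral_fun_comp_mul_comp (f := fun s : ℕ => if s = t then (1 : ℝ) else 0)
    (g := φ) hτ.measurable.aemeasurable hseq.aemeasurable
    (measurable_of_countable _).aestronglyMeasurable hφ.aestronglyMeasurable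
  have e1 : ∫ ω, {ω | τ ω = t}.indicator (b t) ω ∂P =
      ∫ ω, (if τ ω = t then (1 : ℝ) else 0) * φ (fun n => x (n + 1) ω) ∂P := by
    refine integral_congr_ae (Eventually.of_forall fun ω => ?_)
    simp only [Set.indicator_apply, Set.mem_ofPred_eq, hbφ]
    split_ifs <;> simp
  have e2 : ∫ ω, (if τ ω = t then (1 : ℝ) else 0) ∂P = α t / ∑ t ∈ Finset.Icc 1 T, α t := by
    rw [← hτ.law t ht, ← integral_indicator_one (hset t)]
    refine integral_congr_ae (Eventually.of_forall fun ω => ?_)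
    simp [Set.indicator_apply]
  rw [e1, h, e2, integral_const_mul]
  simp only [hbφ]
  ring

omit [IsProbabilityMeasure P] in
theorem IsBestIndex.integral_le {g : ℕ → Ω → ℝ} (hgb : ∀ t ∈ Finset.Icc 1 T, ∀ ω, g t ω = b t ω)
    (hτ : IsBestIndex g T τ) (hα : ∀ t, 1 ≤ t → 0 < α t)
    (hpos : 0 < ∑ t ∈ Finset.Icc 1 T, α t)
    (hb : ∀ t, 1 ≤ t → Integrable (b t) P) (hbm : ∀ t, 1 ≤ t → Measurable (b t))
    (hb0 : ∀ t ω, 0 ≤ b t ω) :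
    Integrable (fun ω => b (τ ω) ω) P ∧ ∫ ω, b (τ ω) ω ∂P ≤
      1 / (∑ t ∈ Finset.Icc 1 T, α t) * ∫ ω, ∑ t ∈ Finset.Icc 1 T, α t * b t ω ∂P := by
  have hle : ∀ ω, ∀ t ∈ Finset.Icc 1 T, b (τ ω) ω ≤ b t ω := fun ω t ht => by
    rw [← hgb t ht, ← hgb _ (hτ ω).1]
    exact (hτ ω).2 t ht
  -- The index itself need not be measurable, but the value is a finite minimum, so its strict
  -- sublevel sets are finite unions of those of the `b t`.
  have hmeas : Measurable fun ω => b (τ ω) ω := by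
    refine measurable_of_Iio fun c => ?_
    have e : (fun ω => b (τ ω) ω) ⁻¹' Set.Iio c =
        ⋃ t ∈ Finset.Icc 1 T, b t ⁻¹' Set.Iio c := by
      ext ω
      simp only [Set.mem_preimage, Set.mem_Iio, Set.mem_iUnion, exists_prop]
      exact ⟨fun h => ⟨τ ω, (hτ ω).1, h⟩, fun ⟨t, ht, h⟩ => (hle ω t ht).trans_lt h⟩
    rw [e]
    exact Finset.measurableSet_biUnion _ fun t ht =>
      hbm t (Finset.mem_Icc.1 ht).1 measurableSet_Iio
  have hsumint : Integrable (fun ω => ∑ t ∈ Finset.Icc 1 T, α t * b t ω) P :=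
    integrable_finsetSum _ fun t ht => (hb t (Finset.mem_Icc.1 ht).1).const_mul _
  have hbound : ∀ ω, b (τ ω) ω ≤
      1 / (∑ t ∈ Finset.Icc 1 T, α t) * ∑ t ∈ Finset.Icc 1 T, α t * b t ω := by
    intro ω
    rw [one_div, inv_mul_eq_div, le_div_iff₀ hpos, mul_comm, Finset.sum_mul]
    exact Finset.sum_le_sum fun t ht =>
      mul_le_mul_of_nonneg_left (hle ω t ht) (hα t (Finset.mem_Icc.1 ht).1).le
  have hint : Integrable (fun ω => b (τ ω) ω) P :=
    (hsumint.const_mul (1 / (∑ t ∈ Finset.Icc 1 T, α t))).mono' hmeas.aestronglyMeasurable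
      (Eventually.of_forall fun ω => by
        rw [Real.norm_of_nonneg (hb0 _ _)]; exact hbound ω)
  refine ⟨hint, ?_⟩
  rw [← integral_const_mul]
  exact integral_mono hint (hsumint.const_mul _) hbound

end RandomIndex

/-! ### Almost sure summability and limit points. -/

section AlmostSure

/-- Nonnegative functions whose partial sums have bounded expectations are summable almost
surely. -/
theorem ae_summable_of_integral_sum_le {Ω : Type*} [MeasurableSpace Ω] {P : Measure Ω}
    {F : ℕ → Ω → ℝ} {C : ℝ} (hF : ∀ n, Integrable (F n) P) (h0 : ∀ n ω, 0 ≤ F n ω)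
    (hC : ∀ n, ∫ ω, ∑ i ∈ Finset.range n, F i ω ∂P ≤ C) : ∀ᵐ ω ∂P, Summable fun n => F n ω := by
  have hm : ∀ n, AEMeasurable (fun ω => ENNReal.ofReal (F n ω)) P := fun n =>
    (hF n).aemeasurable.ennreal_ofReal
  have hlt : ∫⁻ ω, ∑' n, ENNReal.ofReal (F n ω) ∂P < ⊤ := by
    rw [lintegral_tsum hm]
    refine (ENNReal.tsum_le_of_sum_range_le (c := ENNReal.ofReal C) fun n => ?_).trans_lt
      ENNReal.ofReal_lt_top
    have e : ∀ i, ∫⁻ ω, ENNReal.ofReal (F i ω) ∂P = ENNReal.ofReal (∫ ω, F i ω ∂P) := fun i =>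
      (ofReal_integral_eq_lintegral_ofReal (hF i) (Eventually.of_forall (h0 i))).symm
    simp only [e]
    rw [← ENNReal.ofReal_sum_of_nonneg fun i _ => integral_nonneg (h0 i),
      ← integral_finsetSum _ fun i _ => hF i]
    exact ENNReal.ofReal_le_ofReal (hC n)
  filter_upwards [ae_lt_top' (AEMeasurable.tsum hm) hlt.ne] with ω hω
  have h := ENNReal.summable_toReal hω.ne
  simpa [ENNReal.toReal_ofReal (h0 _ ω)] using h

theorem exists_sum_Icc_le {F : ℕ → ℝ} (hF : Summable F) (h0 : ∀ t, 1 ≤ t → 0 ≤ F t) :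
    ∃ C, ∀ T, ∑ t ∈ Finset.Icc 1 T, F t ≤ C := by
  refine ⟨∑' t, F (t + 1), fun T => ?_⟩
  rw [← Finset.Ico_add_one_right_eq_Icc, Finset.sum_Ico_eq_sum_range]
  have h := ((summable_nat_add_iff 1).2 hF).sum_le_tsum (Finset.range T)
    fun i _ => h0 (i + 1) (by omega)
  simpa [add_comm] using h

theorem tendsto_zero_of_sq {u : ℕ → ℝ} (hu : ∀ n, 0 ≤ u n)
    (h : Tendsto (fun n => u n ^ 2) atTop (𝓝 0)) : Tendsto u atTop (𝓝 0) := by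
  have := (Real.continuous_sqrt.tendsto 0).comp h
  rw [Real.sqrt_zero] at this
  exact this.congr fun n => Real.sqrt_sq (hu n)

/-- A bounded sequence approaches every set that contains all its limit points. -/
theorem tendsto_infDist_of_mapClusterPt {E : Type*} [PseudoMetricSpace E] [ProperSpace E]
    {u : ℕ → E} {S : Set E} (hbdd : Bornology.IsBounded (Set.range u))
    (hS : ∀ v, MapClusterPt v atTop u → v ∈ S) :
    S.Nonempty ∧ Tendsto (fun n => Metric.infDist (u n) S) atTop (𝓝 0) := by
  have hsub : ∀ ns : ℕ → ℕ, Tendsto ns atTop atTop → ∃ v ∈ S, ∃ ms : ℕ → ℕ,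
      Tendsto (fun n => u (ns (ms n))) atTop (𝓝 v) := by
    intro ns hns
    obtain ⟨v, -, ms, hms, hlim⟩ := tendsto_subseq_of_bounded hbdd
      (x := u ∘ ns) fun n => Set.mem_range_self _
    exact ⟨v, hS v (MapClusterPt.of_comp (hns.comp hms.tendsto_atTop) hlim.mapClusterPt), ms, hlim⟩
  refine ⟨?_, tendsto_of_subseq_tendsto fun ns hns => ?_⟩
  · obtain ⟨v, hv, -⟩ := hsub id tendsto_id
    exact ⟨v, hv⟩
  · obtain ⟨v, hv, ms, hlim⟩ := hsub ns hns
    refine ⟨ms, ?_⟩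
    have h := ((Metric.continuous_infDist_pt S).tendsto v).comp hlim
    rwa [Metric.infDist_zero_of_mem hv] at h

end AlmostSure

/-! ### Convergence along a path and the rate in expectation. -/

namespace IsStochasticHeavyBall

variable {E Ω X : Type*} [NormedAddCommGroup E] [InnerProductSpace ℝ E]
  {f : E → ℝ} {Θ : Set E} {G : E → X → E} {g Pr : E → E} {ρ r L L₁ : ℝ} {α : ℕ → ℝ} {β : ℝ}
  {θinit zinit : E} {x : ℕ → Ω → X} {θ z : ℕ → Ω → E}
  (M : HeavyBallModel f Θ G g Pr ρ r L L₁ α β)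
  (hS : IsStochasticHeavyBall Θ G α β θinit zinit x θ z) (h0 : θinit ∈ Θ)
include M hS h0

theorem increment_bounded {t : ℕ} (ht : 1 ≤ t) (ω : Ω) :
    ‖θ t ω - θ (t - 1) ω‖ ≤ α 1 * ‖zinit‖ + α 1 * L := by
  have hα1 := (M.α_pos 1 le_rfl).le
  exact increment_le (δ := fun t => ‖θ t ω - θ (t - 1) ω‖) M.β_pos M.β_le M.L_pos.le M.α_pos
    M.α_anti (by simp [hS.theta_zero, hS.theta_one]) (by positivity)
    (increment_two M hS h0 ω) (fun t ht => increment_step M hS h0 ht ω) ht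

/-- This uniform bound serves integrability; it does not enter the rate. -/
theorem residual_extrapolate_le {t : ℕ} (ht : 1 ≤ t) (ω : Ω) :
    ‖extrapolate β θ t ω - Pr (extrapolate β θ t ω)‖ ≤
      L / (r - ρ) + (1 - β) / β * (α 1 * ‖zinit‖ + α 1 * L) := by
  have h1 := M.residual_lip (extrapolate β θ t ω) (θ t ω)
  have h2 := M.residual_le (mem hS h0 t ω)
  rw [norm_extrapolate_sub M] at h1
  have h3 := mul_le_mul_of_nonneg_left (increment_bounded M hS h0 ht ω)
    (div_nonneg (sub_nonneg.2 M.β_le) M.β_pos.le)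
  have h4 := norm_le_norm_add_norm_sub' (extrapolate β θ t ω - Pr (extrapolate β θ t ω))
    (θ t ω - Pr (θ t ω))
  linarith

omit hS h0 in
theorem continuous_residual : Continuous fun u : E => u - Pr u :=
  LipschitzWith.continuous (K := 1) <| LipschitzWith.of_dist_le_mul fun u v => by
    simpa [dist_eq_norm] using M.residual_lip u v

/-- Almost sure convergence, along a path with summable weighted squared residuals. -/
theorem tendsto_residual (hαdiv : ¬ Summable α)
    (hratio : Tendsto (fun t => α t / α (t + 1)) atTop (𝓝 1))
    (hα0 : Tendsto α atTop (𝓝 0)) {ω : Ω}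
    (hsum : Summable fun t => α (t + 1) *
      (r * ‖extrapolate β θ (t + 1) ω - Pr (extrapolate β θ (t + 1) ω)‖) ^ 2) :
    Tendsto (fun t => ‖extrapolate β θ t ω - Pr (extrapolate β θ t ω)‖) atTop (𝓝 0) ∧
    Tendsto (fun t => ‖extrapolate β θ t ω - θ t ω‖) atTop (𝓝 0) := by
  have hr := M.r_pos
  set c := (1 - β) / β with hc
  have hc0 : 0 ≤ c := div_nonneg (sub_nonneg.2 M.β_le) M.β_pos.le
  obtain ⟨C, hC0, hC⟩ := exists_increment_le_mul (δ := fun t => ‖θ t ω - θ (t - 1) ω‖)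
    M.β_pos M.β_le M.L_pos.le M.α_pos (fun t ht => increment_step M hS h0 ht ω) hratio
  have hdist : Tendsto (fun t => ‖extrapolate β θ t ω - θ t ω‖) atTop (𝓝 0) := by
    have hlim : Tendsto (fun t => c * (C * α t)) atTop (𝓝 0) := by
      simpa using (hα0.const_mul C).const_mul c
    refine tendsto_of_tendsto_of_tendsto_of_le_of_le' tendsto_const_nhds hlim
      (Eventually.of_forall fun t => norm_nonneg _) ?_
    filter_upwards [hC] with t ht
    rw [norm_extrapolate_sub M]
    gcongr
  refine ⟨?_, hdist⟩
  -- This turns summability of `α t * b t ^ 2` into that of `α t * b (t + 1) ^ 2`. All eventual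
  -- bounds are arranged to hold from `N` on, and the sequence is shifted by `N`.
  have h2 : ∀ᶠ t in atTop, α t / α (t + 1) < 2 := hratio.eventually_lt_const one_lt_two
  obtain ⟨N, hN⟩ := eventually_atTop.1 (hC.and (h2.and (eventually_ge_atTop 1)))
  set b : ℕ → ℝ := fun t => ‖extrapolate β θ t ω - Pr (extrapolate β θ t ω)‖ with hb
  have hsumb : Summable fun t => α t * b t ^ 2 := by
    have h : Summable fun t => α t * (r * b t) ^ 2 := (summable_nat_add_iff 1).1 hsum
    have e : ∀ B a : ℝ, a * B ^ 2 = (r ^ 2)⁻¹ * (a * (r * B) ^ 2) := fun B a => by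
      field_simp
    simp only [e (b _)]
    exact h.mul_left _
  rw [← tendsto_add_atTop_iff_nat N]
  have hpos : ∀ t, 0 < α (t + N) := fun t => M.α_pos _ (by have := (hN N le_rfl).2.2; omega)
  refine tendsto_zero_of_summable_mul_sq (α := fun t => α (t + N)) (b := fun t => b (t + N))
    (C := (1 + 2 * c) * C)
    (fun t => norm_nonneg _) (by positivity) (fun t => (hpos t).le)
    (fun h => hαdiv ((summable_nat_add_iff N).1 h))
    ((summable_nat_add_iff N).2 hsumb) ?_ fun t => ?_
  · have h := ((summable_nat_add_iff (N + 1)).2 hsumb).mul_left 2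
    refine Summable.of_nonneg_of_le (fun t => by have := (hpos t).le; positivity) (fun t => ?_) h
    have h3 := (hN (t + N) (by omega)).2.1
    have h4 := hpos (t + 1)
    have e : t + N + 1 = t + 1 + N := by ring
    rw [e, div_lt_iff₀ h4] at h3
    have e2 : t + (N + 1) = t + 1 + N := by ring
    rw [e2, ← mul_assoc]
    exact mul_le_mul_of_nonneg_right h3.le (sq_nonneg _)
  · have e : t + 1 + N = t + N + 1 := by ring
    simp only [e]
    set s := t + N
    have hs1 : 1 ≤ s := by have := (hN N le_rfl).2.2; omega
    have h3 := (hN s (by omega)).1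
    have h4 := (hN (s + 1) (by omega)).1
    simp only [Nat.add_sub_cancel] at h4
    have h5 := mul_le_mul_of_nonneg_left (M.α_anti s (s + 1) hs1 (by omega)) hC0
    have h6 : |b (s + 1) - b s| ≤ ‖extrapolate β θ (s + 1) ω - extrapolate β θ s ω‖ :=
      (abs_norm_sub_norm_le _ _).trans (M.residual_lip _ _)
    have h7 : extrapolate β θ (s + 1) ω - extrapolate β θ s ω =
        (θ (s + 1) ω - θ s ω) + (c • (θ (s + 1) ω - θ s ω) - c • (θ s ω - θ (s - 1) ω)) := by
      simp only [extrapolate, Nat.add_sub_cancel, ← hc]; abel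
    have h8 : ‖extrapolate β θ (s + 1) ω - extrapolate β θ s ω‖ ≤
        ‖θ (s + 1) ω - θ s ω‖ + (c * ‖θ (s + 1) ω - θ s ω‖ + c * ‖θ s ω - θ (s - 1) ω‖) := by
      rw [h7]
      refine (norm_add_le _ _).trans (add_le_add_right ((norm_sub_le _ _).trans ?_) _)
      rw [norm_smul, norm_smul, Real.norm_of_nonneg hc0]
    have h9 := mul_le_mul_of_nonneg_left (h4.trans h5) hc0
    have h10 := mul_le_mul_of_nonneg_left h3 hc0
    linarith

section Measure

variable [CompleteSpace E] [MeasurableSpace E] [BorelSpace E] [SecondCountableTopology E]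
  [MeasurableSpace X]
  (hcl : IsClosed Θ) (hG : ∀ u ∈ Θ, Measurable (G u))
include hcl hG

theorem exists_residual_eq_history (m : ℕ) : ∃ φ : (Fin m → X) → ℝ, Measurable φ ∧
    ∀ ω, (r * ‖extrapolate β θ (m + 1) ω - Pr (extrapolate β θ (m + 1) ω)‖) ^ 2 =
      φ (history x m ω) := by
  obtain ⟨Φ, Φ', hΦ, hΦ', -, hθ, hθ'⟩ := exists_eq_history M hS h0 hcl hG m
  refine ⟨fun h => (r * ‖(Φ h + ((1 - β) / β) • (Φ h - Φ' h)) -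
    Pr (Φ h + ((1 - β) / β) • (Φ h - Φ' h))‖) ^ 2, ?_, fun ω => ?_⟩
  · exact (((continuous_residual M).measurable.comp
      (hΦ.add ((hΦ.sub hΦ').const_smul _))).norm.const_mul r).pow_const 2
  · rw [extrapolate, Nat.add_sub_cancel, hθ, hθ']

variable [MeasurableSpace Ω] {P : Measure Ω} [IsProbabilityMeasure P]
  (hx : ∀ n, Measurable (x n))
include hx

omit [IsProbabilityMeasure P] in
theorem measurable_residual {t : ℕ} (ht : 1 ≤ t) : Measurable fun ω =>
    (r * ‖extrapolate β θ t ω - Pr (extrapolate β θ t ω)‖) ^ 2 := by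
  obtain ⟨m, rfl⟩ : ∃ m, t = m + 1 := ⟨t - 1, by omega⟩
  obtain ⟨φ, hφ, he⟩ := exists_residual_eq_history M hS h0 hcl hG m
  simp only [he]
  exact hφ.comp (measurable_history hx m)

theorem integrable_residual {t : ℕ} (ht : 1 ≤ t) : Integrable (fun ω =>
    (r * ‖extrapolate β θ t ω - Pr (extrapolate β θ t ω)‖) ^ 2) P := by
  have hr := M.r_pos
  refine Integrable.of_bound (measurable_residual M hS h0 hcl hG hx ht).aestronglyMeasurable
    ((r * (L / (r - ρ) + (1 - β) / β * (α 1 * ‖zinit‖ + α 1 * L))) ^ 2)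
    (Eventually.of_forall fun ω => ?_)
  rw [Real.norm_of_nonneg (sq_nonneg _)]
  have := residual_extrapolate_le M hS h0 ht ω
  gcongr

/-- The rate in expectation, for the weighted sum of the squared gradients. -/
theorem expected_rate [StandardBorelSpace X] [Nonempty X]
    {π : Measure X} [IsProbabilityMeasure π] (hg : ∀ u ∈ Θ, g u = ∫ y, G u y ∂π)
    {k : ℕ → ℕ} (hk : ∀ t, 1 ≤ t → 1 ≤ k t ∧ k t ≤ t) {T : ℕ} (hT : 1 ≤ T) :
    ∫ ω, ∑ t ∈ Finset.Icc 1 T,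
        α t * (r * ‖extrapolate β θ t ω - Pr (extrapolate β θ t ω)‖) ^ 2 ∂P ≤
      6 * (moreauEnvelope f Θ (1 / r) θinit - ⨅ y, moreauEnvelope f Θ (1 / r) y) +
      r * ((6 + shbConst ρ r L₁ (α 1) * (1 - β) ^ 2 / β ^ 2) * L ^ 2
            * ∑ t ∈ Finset.Icc 1 T, α t ^ 2
          + shbConst ρ r L₁ (α 1) / β ^ 3 * (α 1 ^ 2 * ‖zinit‖ ^ 2)
          + 4 * L ^ 2 / (r - ρ)
            * ∑ t ∈ Finset.Icc 1 T, α t * mixingCoeff P π x (t - k t) (t + 1)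
          + 16 * L ^ 2 * (L₁ + r) / (r - ρ)
            * ∑ t ∈ Finset.Icc 1 T, (k t : ℝ) * α t * α (max 1 (t - k t))) := by
  have hr := M.r_pos
  have hrρ := sub_pos.2 M.rho_lt
  have hL := M.L_pos
  have hnoise : ∀ t ∈ Finset.Icc 2 T, Integrable
      (fun ω => noiseTerm G g Pr (θ (t - k (t - 1)) ω) (x t ω)) P ∧
      |∫ ω, noiseTerm G g Pr (θ (t - k (t - 1)) ω) (x t ω) ∂P| ≤
        2 * (L * (L / (r - ρ))) * mixingCoeff P π x (t - 1 - k (t - 1)) (t - 1 + 1) := by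
    intro t ht
    have ht2 := (Finset.mem_Icc.1 ht).1
    have hkt := hk (t - 1) (by omega)
    have h := abs_integral_noiseTerm_le (P := P) M hS h0 hcl hG hx hg (t - 1 - k (t - 1)) t
    -- `θ_{m+1}` depends on the first `m` samples only. With `m = t - 1 - k (t - 1)`, the sample
    -- `x_t` pairs with the mixing coefficient of index `t - 1`.
    rw [show t - 1 - k (t - 1) + 1 = t - k (t - 1) by omega] at h
    rwa [show t - 1 + 1 = t by omega]
  have hsumint : Integrable (fun ω => ∑ t ∈ Finset.Icc 2 T,
      α t * noiseTerm G g Pr (θ (t - k (t - 1)) ω) (x t ω)) P :=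
    integrable_finsetSum _ fun t ht => (hnoise t ht).1.const_mul _
  have hlow : -(2 * (L * (L / (r - ρ))) * ∑ t ∈ Finset.Icc 1 T,
      α t * mixingCoeff P π x (t - k t) (t + 1)) ≤ ∫ ω, ∑ t ∈ Finset.Icc 2 T,
      α t * noiseTerm G g Pr (θ (t - k (t - 1)) ω) (x t ω) ∂P := by
    rw [integral_finsetSum _ fun t ht => (hnoise t ht).1.const_mul _]
    have h1 := sum_Icc_pred_le (F := fun t => α t * mixingCoeff P π x (t - k t) (t + 1))
      (fun t ht => mul_nonneg (M.α_pos t ht).le (mixingCoeff_nonneg hx _ _)) T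
    have h2 : 0 ≤ 2 * (L * (L / (r - ρ))) := by positivity
    refine (neg_le_neg (mul_le_mul_of_nonneg_left h1 h2)).trans ?_
    rw [Finset.mul_sum, ← Finset.sum_neg_distrib]
    refine Finset.sum_le_sum fun t ht => ?_
    have ht2 := (Finset.mem_Icc.1 ht).1
    have hαt := (M.α_pos t (by omega)).le
    rw [integral_const_mul]
    have h3 := (abs_le.1 (hnoise t ht).2).1
    have h4 := mul_le_mul_of_nonneg_left h3 hαt
    have h5 := mul_le_mul_of_nonneg_right (M.α_anti (t - 1) t (by omega) (by omega))
      (mul_nonneg h2 (mixingCoeff_nonneg (P := P) (π := π) hx (t - 1 - k (t - 1)) (t - 1 + 1)))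
    linarith
  set A := 6 * (moreauEnvelope f Θ (1 / r) θinit - ⨅ y, moreauEnvelope f Θ (1 / r) y) +
      r * ((6 + shbConst ρ r L₁ (α 1) * (1 - β) ^ 2 / β ^ 2) * L ^ 2
            * ∑ t ∈ Finset.Icc 1 T, α t ^ 2
          + shbConst ρ r L₁ (α 1) / β ^ 3 * (α 1 ^ 2 * ‖zinit‖ ^ 2)
          + 16 * L ^ 2 * (L₁ + r) / (r - ρ)
            * ∑ t ∈ Finset.Icc 1 T, (k t : ℝ) * α t * α (max 1 (t - k t))) with hA
  have hmono := integral_mono (μ := P)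
    (g := fun ω => A - 2 * r * ∑ t ∈ Finset.Icc 2 T,
      α t * noiseTerm G g Pr (θ (t - k (t - 1)) ω) (x t ω))
    (integrable_finsetSum _ fun t ht =>
      (integrable_residual M hS h0 hcl hG hx (Finset.mem_Icc.1 ht).1).const_mul (α t))
    ((integrable_const A).sub (hsumint.const_mul (2 * r)))
    (fun ω => (pathwise_rate M hS h0 hk hT ω).trans_eq (by rw [hA]; ring))
  refine hmono.trans ?_
  rw [integral_sub (integrable_const A) (hsumint.const_mul _), integral_const_mul, integral_const,
    probReal_univ, one_smul]
  have h6 := mul_le_mul_of_nonneg_left hlow hr.le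
  have e : 4 * L ^ 2 / (r - ρ) * ∑ t ∈ Finset.Icc 1 T, α t * mixingCoeff P π x (t - k t) (t + 1) =
    2 * (2 * (L * (L / (r - ρ))) * ∑ t ∈ Finset.Icc 1 T,
      α t * mixingCoeff P π x (t - k t) (t + 1)) := by ring
  rw [e]
  linarith only [h6, hA]

end Measure

end IsStochasticHeavyBall

namespace HeavyBallModel

theorem shbConst_nonneg {E X : Type*} [NormedAddCommGroup E] [InnerProductSpace ℝ E]
    {f : E → ℝ} {Θ : Set E} {G : E → X → E} {g Pr : E → E} {ρ r L L₁ : ℝ} {α : ℕ → ℝ} {β : ℝ}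
    (M : HeavyBallModel f Θ G g Pr ρ r L L₁ α β) : 0 ≤ shbConst ρ r L₁ (α 1) := by
  have hr := M.r_pos
  have hrρ := sub_pos.2 M.rho_lt
  have hL₁ := M.L₁_pos
  have hα := M.α_pos 1 le_rfl
  rw [shbConst]
  positivity

theorem sum_α_pos {E X : Type*} [NormedAddCommGroup E] [InnerProductSpace ℝ E]
    {f : E → ℝ} {Θ : Set E} {G : E → X → E} {g Pr : E → E} {ρ r L L₁ : ℝ} {α : ℕ → ℝ} {β : ℝ}
    (M : HeavyBallModel f Θ G g Pr ρ r L L₁ α β) {T : ℕ} (hT : 1 ≤ T) :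
    0 < ∑ t ∈ Finset.Icc 1 T, α t :=
  Finset.sum_pos (fun t ht => M.α_pos t (Finset.mem_Icc.1 ht).1) ⟨1, by simp [hT]⟩

end HeavyBallModel

namespace IsStochasticHeavyBall

variable {E Ω X : Type*} [NormedAddCommGroup E] [InnerProductSpace ℝ E] [CompleteSpace E]
  [MeasurableSpace E] [BorelSpace E] [SecondCountableTopology E]
  [MeasurableSpace X] [StandardBorelSpace X] [Nonempty X] [MeasurableSpace Ω]
  {P : Measure Ω} [IsProbabilityMeasure P] {π : Measure X} [IsProbabilityMeasure π]
  {f : E → ℝ} {Θ : Set E} {G : E → X → E} {g Pr : E → E} {ρ r L L₁ : ℝ} {α : ℕ → ℝ} {β : ℝ}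
  {θinit zinit : E} {x : ℕ → Ω → X} {θ z : ℕ → Ω → E}

theorem ae_summable_residual (M : HeavyBallModel f Θ G g Pr ρ r L L₁ α β)
    (hS : IsStochasticHeavyBall Θ G α β θinit zinit x θ z) (h0 : θinit ∈ Θ)
    (hcl : IsClosed Θ) (hG : ∀ u ∈ Θ, Measurable (G u)) (hx : ∀ n, Measurable (x n))
    (hg : ∀ u ∈ Θ, g u = ∫ y, G u y ∂π)
    {k : ℕ → ℕ} (hk : ∀ t, 1 ≤ t → 1 ≤ k t ∧ k t ≤ t)
    (hΔ : Summable fun t => α t * mixingCoeff P π x (t - k t) (t + 1))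
    (hα2 : Summable fun t => α t ^ 2)
    (hkα : Summable fun t => (k t : ℝ) * α t * α (max 1 (t - k t))) :
    ∀ᵐ ω ∂P, Summable fun t => α (t + 1) *
      (r * ‖extrapolate β θ (t + 1) ω - Pr (extrapolate β θ (t + 1) ω)‖) ^ 2 := by
  have hr := M.r_pos
  have hrρ := sub_pos.2 M.rho_lt
  have hL₁ := M.L₁_pos
  have hC := M.shbConst_nonneg
  have hβ := M.β_pos
  obtain ⟨C₁, hC₁⟩ := exists_sum_Icc_le hα2 fun t _ => sq_nonneg _
  obtain ⟨C₂, hC₂⟩ := exists_sum_Icc_le hΔ fun t ht =>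
    mul_nonneg (M.α_pos t ht).le (mixingCoeff_nonneg hx _ _)
  obtain ⟨C₃, hC₃⟩ := exists_sum_Icc_le hkα fun t ht =>
    mul_nonneg (mul_nonneg (Nat.cast_nonneg _) (M.α_pos t ht).le)
      (M.α_pos (max 1 (t - k t)) (le_max_left _ _)).le
  refine ae_summable_of_integral_sum_le
    (C := max 0 (6 * (moreauEnvelope f Θ (1 / r) θinit - ⨅ y, moreauEnvelope f Θ (1 / r) y) +
      r * ((6 + shbConst ρ r L₁ (α 1) * (1 - β) ^ 2 / β ^ 2) * L ^ 2 * C₁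
          + shbConst ρ r L₁ (α 1) / β ^ 3 * (α 1 ^ 2 * ‖zinit‖ ^ 2)
          + 4 * L ^ 2 / (r - ρ) * C₂ + 16 * L ^ 2 * (L₁ + r) / (r - ρ) * C₃)))
    (fun t => (integrable_residual M hS h0 hcl hG hx (by omega)).const_mul _)
    (fun t ω => mul_nonneg (M.α_pos _ (by omega)).le (sq_nonneg _)) fun T => ?_
  -- The rate needs `T ≥ 1`; the `max 0` in the constant covers the empty sum.
  rcases Nat.eq_zero_or_pos T with rfl | hT
  · simp
  · have h := expected_rate (P := P) M hS h0 hcl hG hx hg hk hT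
    have e : ∀ F : ℕ → ℝ, ∑ i ∈ Finset.range T, F (i + 1) = ∑ t ∈ Finset.Icc 1 T, F t := by
      intro F
      rw [← Finset.Ico_add_one_right_eq_Icc, Finset.sum_Ico_eq_sum_range]
      simp [add_comm]
    have e2 : ∀ ω, ∑ i ∈ Finset.range T, α (i + 1) *
        (r * ‖extrapolate β θ (i + 1) ω - Pr (extrapolate β θ (i + 1) ω)‖) ^ 2 =
        ∑ t ∈ Finset.Icc 1 T, α t *
          (r * ‖extrapolate β θ t ω - Pr (extrapolate β θ t ω)‖) ^ 2 := fun ω =>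
      e fun t => α t * (r * ‖extrapolate β θ t ω - Pr (extrapolate β θ t ω)‖) ^ 2
    simp only [e2]
    refine (h.trans ?_).trans (le_max_right _ _)
    have h1 := hC₁ T
    have h2 := hC₂ T
    have h3 := hC₃ T
    gcongr

end IsStochasticHeavyBall

/-! ### The main theorem. -/

theorem mainTheorem3 {p : ℕ} {Ω X : Type*} [MeasurableSpace Ω]
    [MeasurableSpace X] [StandardBorelSpace X] [Nonempty X]
    (P : Measure Ω) [IsProbabilityMeasure P] (π : Measure X) [IsProbabilityMeasure π]
    -- objective, constraint set and stochastic subgradients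
    (f : EuclideanSpace ℝ (Fin p) → ℝ) (Θ : Set (EuclideanSpace ℝ (Fin p)))
    (G : EuclideanSpace ℝ (Fin p) → X → EuclideanSpace ℝ (Fin p))
    (ρ ρhat L L₁ : ℝ) (hρ : 0 < ρ) (hρhat : 2 * ρ ≤ ρhat) (hL : 0 < L) (hL₁ : 0 < L₁)
    (hΘ_closed : IsClosed Θ) (hΘ_convex : Convex ℝ Θ)
    (hf_weak : WeaklyConvexOn ρ Θ f) (hf_bdd : BddBelow (f '' Θ))
    (hG_meas : ∀ θ ∈ Θ, Measurable (G θ))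
    (hG_sub : ∀ θ ∈ Θ, ∫ y, G θ y ∂π ∈ subdifferential f θ)
    (hG_lip : ∀ y, ∀ θ ∈ Θ, ∀ θ' ∈ Θ, ‖G θ y - G θ' y‖ ≤ L₁ * ‖θ - θ'‖)
    (hG_bdd : ∀ θ ∈ Θ, ∀ y, ‖G θ y‖ ≤ L)
    -- step sizes
    (α : ℕ → ℝ) (hα_pos : ∀ t, 1 ≤ t → 0 < α t) (hα_anti : ∀ t, 1 ≤ t → α (t + 1) ≤ α t)
    -- data and mixing
    (x : ℕ → Ω → X) (hx : ∀ n, Measurable (x n))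
    (k : ℕ → ℕ) (hk : ∀ t, 1 ≤ t → 1 ≤ k t ∧ k t ≤ t) (hk_div : Tendsto k atTop atTop)
    (hΔ_lim : Tendsto (fun t => mixingCoeff P π x (t - k t) (t + 1)) atTop (𝓝 0))
    (hΔ_sum : Summable (fun t => α t * mixingCoeff P π x (t - k t) (t + 1)))
    -- the algorithm
    (β : ℝ) (hβ : β ∈ Set.Ioc (0 : ℝ) 1)
    (θinit zinit : EuclideanSpace ℝ (Fin p)) (hθinit : θinit ∈ Θ)
    (θ z : ℕ → Ω → EuclideanSpace ℝ (Fin p))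
    (hSHB : IsStochasticHeavyBall Θ G α β θinit zinit x θ z) :
    -- the proximal map and the gradient of the Moreau envelope are well defined
    (∀ ϑ, ∃! q, IsProxPoint f Θ (1 / ρhat) ϑ q) ∧
    Differentiable ℝ (moreauEnvelope f Θ (1 / ρhat)) ∧
    -- (i)
    (∀ T : ℕ, 1 ≤ T → ∀ τ : Ω → ℕ,
      (IsRandomIndex P α x T τ ∨
        IsBestIndex (fun t ω =>
          ‖gradient (moreauEnvelope f Θ (1 / ρhat)) (extrapolate β θ t ω)‖ ^ 2) T τ) →
      Integrable (fun ω =>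
        ‖gradient (moreauEnvelope f Θ (1 / ρhat)) (extrapolate β θ (τ ω) ω)‖ ^ 2) P ∧
      ∫ ω, ‖gradient (moreauEnvelope f Θ (1 / ρhat)) (extrapolate β θ (τ ω) ω)‖ ^ 2 ∂P ≤
        1 / (∑ t ∈ Finset.Icc 1 T, α t) *
          (6 * (moreauEnvelope f Θ (1 / ρhat) θinit - ⨅ ϑ, moreauEnvelope f Θ (1 / ρhat) ϑ)
            + ρhat *
              ((6 + shbConst ρ ρhat L₁ (α 1) * (1 - β) ^ 2 / β ^ 2) * L ^ 2
                  * ∑ t ∈ Finset.Icc 1 T, α t ^ 2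
                + shbConst ρ ρhat L₁ (α 1) / β ^ 3 * (α 1 ^ 2 * ‖zinit‖ ^ 2)
                + 4 * L ^ 2 / (ρhat - ρ)
                  * ∑ t ∈ Finset.Icc 1 T, α t * mixingCoeff P π x (t - k t) (t + 1)
                + 16 * L ^ 2 * (L₁ + ρhat) / (ρhat - ρ)
                  * ∑ t ∈ Finset.Icc 1 T, (k t : ℝ) * α t * α (max 1 (t - k t))))) ∧
    -- (ii)
    (¬ Summable α →
      Tendsto (fun t => α t / α (t + 1)) atTop (𝓝 1) →
      Summable (fun t => (k t : ℝ) * α t * α (max 1 (t - k t))) →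
      (∀ᵐ ω ∂P,
        Tendsto (fun t => ‖gradient (moreauEnvelope f Θ (1 / ρhat)) (θ t ω)‖) atTop (𝓝 0) ∧
        Tendsto (fun t => ‖gradient (moreauEnvelope f Θ (1 / ρhat))
          (extrapolate β θ t ω)‖) atTop (𝓝 0) ∧
        Tendsto (fun t => ‖gradient (moreauEnvelope f Θ (1 / ρhat))
          (proxPoint f Θ (1 / ρhat) (extrapolate β θ t ω))‖) atTop (𝓝 0)) ∧
      (∀ U : Set (EuclideanSpace ℝ (Fin p)), IsOpen U → Θ ⊆ U → ContDiffOn ℝ 1 f U →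
        ∀ᵐ ω ∂P,
          (∀ ϑ, MapClusterPt ϑ atTop (fun t => θ t ω) → ϑ ∈ stationarySet f Θ) ∧
          (Bornology.IsBounded (Set.range (fun t => θ t ω)) →
            (stationarySet f Θ).Nonempty ∧
            Tendsto (fun t => Metric.infDist (θ t ω) (stationarySet f Θ)) atTop (𝓝 0)))) := by
  have hr : 0 < ρhat := by linarith
  have hGint : ∀ u ∈ Θ, Integrable (G u) π := fun u hu =>
    Integrable.of_bound (hG_meas u hu).aestronglyMeasurable L
      (Eventually.of_forall (hG_bdd u hu))
  set g : EuclideanSpace ℝ (Fin p) → EuclideanSpace ℝ (Fin p) := fun u => ∫ y, G u y ∂π with hg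
  set Pr := proxPoint f Θ (1 / ρhat) with hPr_def
  have hgL : ∀ u ∈ Θ, ‖g u‖ ≤ L := fun u hu => by
    simpa using norm_integral_le_of_norm_le_const (μ := π) (Eventually.of_forall (hG_bdd u hu))
  have hg_lip : ∀ u ∈ Θ, ∀ v ∈ Θ, ‖g u - g v‖ ≤ L₁ * ‖u - v‖ := fun u hu v hv => by
    rw [hg, ← integral_sub (hGint u hu) (hGint v hv)]
    simpa using norm_integral_le_of_norm_le_const (μ := π)
      (Eventually.of_forall fun y => hG_lip y u hu v hv)
  have hPr : ∀ u, IsProxPoint f Θ (1 / ρhat) u (Pr u) := fun u =>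
    isProxPoint_proxPoint (exists_isProxPoint hρ.le hr hf_weak hΘ_closed ⟨θinit, hθinit⟩ hf_bdd
      hG_sub hgL u)
  have hα_le : ∀ s t, 1 ≤ s → s ≤ t → α t ≤ α s := by
    intro s t hs hst
    induction t, hst using Nat.le_induction with
    | base => exact le_rfl
    | succ t ht ih => exact (hα_anti t (hs.trans ht)).trans ih
  have M : HeavyBallModel f Θ G g Pr ρ ρhat L L₁ α β :=
    ⟨hρ, hρhat, hL, hL₁, hΘ_convex, hf_weak, hf_bdd, hPr, hG_sub, hgL, hg_lip, hG_lip, hG_bdd,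
      hα_pos, hα_le, hβ.1, hβ.2⟩
  have hgrad := norm_gradient_moreauEnvelope hf_weak hρhat hr hPr
  refine ⟨fun u => ⟨Pr u, hPr u, fun q hq => hq.unique hf_weak M.rho_lt (hPr u)⟩,
    fun u => (hasGradientAt_moreauEnvelope hf_weak hρhat hr hPr u).hasFDerivAt.differentiableAt,
    fun T hT τ hτ => ?_, fun hdiv hratio hkα => ?_⟩
  · simp only [hgrad] at hτ ⊢
    set b : ℕ → Ω → ℝ := fun t ω =>
      (ρhat * ‖extrapolate β θ t ω - Pr (extrapolate β θ t ω)‖) ^ 2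
    have hrate := IsStochasticHeavyBall.expected_rate (P := P) (π := π) M hSHB hθinit hΘ_closed
      hG_meas hx (fun _ _ => rfl) hk hT
    have hpos := M.sum_α_pos hT
    have hint : ∀ t, 1 ≤ t → Integrable (b t) P := fun t ht =>
      IsStochasticHeavyBall.integrable_residual M hSHB hθinit hΘ_closed hG_meas hx ht
    have key : Integrable (fun ω => b (τ ω) ω) P ∧ ∫ ω, b (τ ω) ω ∂P ≤
        1 / (∑ t ∈ Finset.Icc 1 T, α t) * ∫ ω, ∑ t ∈ Finset.Icc 1 T, α t * b t ω ∂P := by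
      rcases hτ with hτ | hτ
      · refine hτ.integral_le hx hpos hint fun t ht => ?_
        obtain ⟨m, rfl⟩ : ∃ m, t = m + 1 := ⟨t - 1, by omega⟩
        obtain ⟨φ, hφ, he⟩ := IsStochasticHeavyBall.exists_residual_eq_history M hSHB hθinit
          hΘ_closed hG_meas m
        exact ⟨fun s => φ fun i => s i,
          hφ.comp (measurable_pi_lambda _ fun i => measurable_pi_apply _), he⟩
      · exact hτ.integral_le (fun _ _ _ => rfl) hα_pos hpos hint
          (fun t ht => IsStochasticHeavyBall.measurable_residual M hSHB hθinit hΘ_closed hG_meas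
            hx ht) fun _ _ => sq_nonneg _
    exact ⟨key.1, key.2.trans (mul_le_mul_of_nonneg_left hrate (by positivity))⟩
  -- Since `k t ≥ 1` and the step sizes decrease, `α t ^ 2` is dominated by `k t * α t * α (max 1 (t
  -- - k t))`.
  · have hα2 : Summable fun t => α t ^ 2 := by
      rw [← summable_nat_add_iff 1]
      refine Summable.of_nonneg_of_le (fun t => sq_nonneg _) (fun t => ?_)
        ((summable_nat_add_iff 1).2 hkα)
      have h1 : (1 : ℝ) ≤ k (t + 1) := by exact_mod_cast (hk (t + 1) (by omega)).1
      have h2 := hα_le (max 1 (t + 1 - k (t + 1))) (t + 1) (le_max_left _ _)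
        (max_le (by omega) (by omega))
      have h3 := (hα_pos (t + 1) (by omega)).le
      calc α (t + 1) ^ 2 = 1 * α (t + 1) * α (t + 1) := by ring
        _ ≤ _ := by gcongr
    have hα0 : Tendsto α atTop (𝓝 0) := by
      rw [← tendsto_add_atTop_iff_nat 1]
      exact tendsto_zero_of_sq (fun n => (hα_pos _ (by omega)).le)
        ((tendsto_add_atTop_iff_nat 1).2 hα2.tendsto_atTop_zero)
    have hconv : ∀ᵐ ω ∂P,
        Tendsto (fun t => ‖extrapolate β θ t ω - Pr (extrapolate β θ t ω)‖) atTop (𝓝 0) ∧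
        Tendsto (fun t => ‖extrapolate β θ t ω - θ t ω‖) atTop (𝓝 0) := by
      filter_upwards [IsStochasticHeavyBall.ae_summable_residual M hSHB hθinit hΘ_closed hG_meas
        hx (fun _ _ => rfl) hk hΔ_sum hα2 hkα] with ω hω
      exact IsStochasticHeavyBall.tendsto_residual M hSHB hθinit hdiv hratio hα0 hω
    have htransfer : ∀ {u v : ℕ → EuclideanSpace ℝ (Fin p)},
        Tendsto (fun t => ‖u t - Pr (u t)‖) atTop (𝓝 0) →
        Tendsto (fun t => ‖u t - v t‖) atTop (𝓝 0) →
        Tendsto (fun t => ‖v t - Pr (v t)‖) atTop (𝓝 0) := by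
      intro u v hu huv
      refine squeeze_zero (fun _ => norm_nonneg _) (fun t => ?_) (by simpa using hu.add huv)
      have h1 := M.residual_lip (v t) (u t)
      have h2 := norm_le_norm_add_norm_sub' (v t - Pr (v t)) (u t - Pr (u t))
      rw [norm_sub_rev (v t) (u t)] at h1
      linarith
    have hscale : ∀ {u : ℕ → EuclideanSpace ℝ (Fin p)},
        Tendsto (fun t => ‖u t - Pr (u t)‖) atTop (𝓝 0) →
        Tendsto (fun t => ρhat * ‖u t - Pr (u t)‖) atTop (𝓝 0) := fun hu => by
      simpa using hu.const_mul ρhat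
    refine ⟨?_, fun U _ _ _ => ?_⟩
    · filter_upwards [hconv] with ω hω
      simp only [hgrad]
      -- For the proximal points the distance to `θ̄_t` is the residual itself, so the same limit is
      -- used twice.
      exact ⟨hscale (htransfer hω.1 hω.2), hscale hω.1, hscale (htransfer hω.1 hω.1)⟩
    · filter_upwards [hconv] with ω hω
      have hres := htransfer hω.1 hω.2
      have hcluster : ∀ ϑ, MapClusterPt ϑ atTop (fun t => θ t ω) → ϑ ∈ stationarySet f Θ := by
        intro ϑ hϑ
        obtain ⟨φ, hφ, hlim⟩ := hϑ.tendsto_subseq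
        have h1 := ((IsStochasticHeavyBall.continuous_residual M).norm.tendsto ϑ).comp hlim
        have h2 := hres.comp hφ.tendsto_atTop
        -- By continuity the residual vanishes at the limit point, so it is a fixed point of the
        -- proximal map.
        have h3 : ϑ = Pr ϑ := sub_eq_zero.1 (norm_eq_zero.1 (tendsto_nhds_unique h1 h2))
        have h4 := hPr ϑ
        rw [← h3] at h4
        exact mem_stationarySet_of_isProxPoint hρ.le hf_weak hG_sub hg_lip h4
      exact ⟨hcluster, fun hbdd => tendsto_infDist_of_mapClusterPt hbdd hcluster⟩
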